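/- Consider walks in $\mathbb{Z}^2$ that start from $(0,0)$ and take diagonal steps $(1,1),(1,-1),(-1,1),(-1,-1)$. Such a walk $(w_0,\dots,w_n)$ is a walk of length $n$ on the slit plane if none of $w_1,\dots,w_n$ lies on the half-line $\{(k,0): k\le 0\}$. Let $a_{i,j}(n)$ be the number of walks of length $n$ on the slit plane that end at $(i,j)$, let $a(n)=\sum_{i,j}a_{i,j}(n)$, and let $$S(x,y;t)=\sum_{n\ge 0}\sum_{i\in\mathbb{Z}}\sum_{j\in\mathbb{Z}}a_{i,j}(n)\,x^iy^jt^n,$$ a formal power series in $t$ whose coefficients are Laurent polynomials in $x$ and $y$. Write $\bar x=1/x$, $\bar y=1/y$; roots of power series in $t$ are the ones with positive real constant term. Then $$S(x,y;t)=\frac{\left(1-8t^2(1+\bar x^2)+\sqrt{1-16t^2}\right)^{1/2}}{\sqrt2\,\bigl(1-t(x+\bar x)(y+\bar y)\bigr)}.$$ This series is algebraic of degree $4$ over the field $k(x,y,t)$ of rational functions, for every field $k$ of characteristic zero (in particular for $k=\mathbb{Q}$ and $k=\mathbb{R}$). When $x=y=1$, it specializes to $$S(1,1;t)=\sum_{n\ge0}a(n)t^n=\frac{(1+4t)^{1/4}\left(1+\sqrt{1-16t^2}\right)^{1/2}}{\sqrt2\,(1-4t)^{3/4}},$$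 and, as $n\to\infty$, $$a(n)\sim\frac{1}{2^{1/4}\,\Gamma(3/4)}\,4^n\,n^{-1/4}.$$ -/

import Mathlib

open Filter Asymptotics

open scoped PowerSeries

universe u

noncomputable section

/-! ### Walks on the slit plane with diagonal steps -/

/-- The four diagonal steps `(1,1)`, `(1,-1)`, `(-1,1)`, `(-1,-1)`. -/
def diagonalSteps : Set (ℤ × ℤ) := {(1, 1), (1, -1), (-1, 1), (-1, -1)}

/-- The forbidden half-line `{(k, 0) : k ≤ 0}`. -/
def halfLine : Set (ℤ × ℤ) := {p | p.1 ≤ 0 ∧ p.2 = 0}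

/-- `w = (w 0, …, w n)` is a walk of length `n` on the slit plane with diagonal steps: it starts
from the origin, takes diagonal steps, and none of the vertices `w 1, …, w n` is on the
forbidden half-line. -/
structure IsSlitWalk (n : ℕ) (w : Fin (n + 1) → ℤ × ℤ) : Prop where
  start : w 0 = (0, 0)
  step : ∀ k : Fin n, w k.succ - w k.castSucc ∈ diagonalSteps
  avoid : ∀ k : Fin n, w k.succ ∉ halfLine

/-- The number `a_{i,j}(n)` of walks of length `n` on the slit plane that end at `p = (i, j)`. -/
def numWalksTo (n : ℕ) (p : ℤ × ℤ) : ℕ :=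
  Set.ncard {w : Fin (n + 1) → ℤ × ℤ | IsSlitWalk n w ∧ w (Fin.last n) = p}

/-- The number `a(n)` of walks of length `n` on the slit plane, regardless of the endpoint. -/
def numWalks (n : ℕ) : ℕ :=
  Set.ncard {w : Fin (n + 1) → ℤ × ℤ | IsSlitWalk n w}

theorem IsSlitWalk.coord_le {n : ℕ} {w : Fin (n + 1) → ℤ × ℤ} (hw : IsSlitWalk n w)
    (k : Fin (n + 1)) : |(w k).1| ≤ (k : ℕ) ∧ |(w k).2| ≤ (k : ℕ) := by
  induction k using Fin.induction with
  | zero => simp [hw.start]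
  | succ k ih =>
    have h := hw.step k
    simp only [diagonalSteps, Set.mem_insert_iff, Set.mem_singleton_iff, Prod.ext_iff,
      Prod.fst_sub, Prod.snd_sub] at h
    simp only [abs_le, Fin.val_succ, Fin.val_castSucc, Nat.cast_add, Nat.cast_one] at ih ⊢
    omega

theorem mem_box_of_numWalksTo_ne_zero {n : ℕ} {p : ℤ × ℤ} (h : numWalksTo n p ≠ 0) :
    p ∈ Finset.Icc (-(n : ℤ)) n ×ˢ Finset.Icc (-(n : ℤ)) n := by
  obtain ⟨w, hw, rfl⟩ := Set.nonempty_of_ncard_ne_zero h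
  have := hw.coord_le (Fin.last n)
  simpa [abs_le] using this

/-! ### The complete generating function -/

/-- The ring `R[x, 1/x, y, 1/y]` of Laurent polynomials in `x` and `y`. -/
abbrev Laurent₂ (R : Type u) [CommRing R] : Type u := AddMonoidAlgebra R (ℤ × ℤ)

/-- The Laurent monomial `x ^ i * y ^ j`. -/
def mon (R : Type u) [CommRing R] (i j : ℤ) : Laurent₂ R := AddMonoidAlgebra.single (i, j) 1

/-- The coefficient of `t ^ n` in the complete generating function: the Laurent polynomial
`∑ i, ∑ j, a_{i,j}(n) x ^ i y ^ j`. -/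
def slitCoeff (R : Type u) [CommRing R] (n : ℕ) : Laurent₂ R :=
  AddMonoidAlgebra.ofCoeff <| Finsupp.onFinset
    (Finset.Icc (-(n : ℤ)) n ×ˢ Finset.Icc (-(n : ℤ)) n)
    (fun p => (numWalksTo n p : R))
    (fun p hp => mem_box_of_numWalksTo_ne_zero fun h => hp (by simp [h]))

/-- The complete generating function `S(x, y; t) = ∑ n, ∑ i, ∑ j, a_{i,j}(n) x ^ i y ^ j t ^ n`, a
power series in `t` with coefficients in `R[x, 1/x, y, 1/y]`. -/
def slitSeries (R : Type u) [CommRing R] : (Laurent₂ R)⟦X⟧ := PowerSeries.mk (slitCoeff R)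

/-- The specialization `x = y = 1` of Laurent polynomials. -/
def evalOne (R : Type u) [CommRing R] : Laurent₂ R →+* R :=
  (AddMonoidAlgebra.lift R R (ℤ × ℤ) (1 : Multiplicative (ℤ × ℤ) →* R)).toRingHom

/-! ### Roots of power series -/

/-- `g = f ^ (1 / m)` as a formal power series: `g ^ m = f`, and the constant term of `g` is a
positive real number. -/
def IsPosRoot {R : Type u} [CommRing R] [Algebra ℝ R] (m : ℕ) (f g : R⟦X⟧) : Prop :=
  g ^ m = f ∧ ∃ c : ℝ, 0 < c ∧ PowerSeries.constantCoeff g = algebraMap ℝ R c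

/-- There is at most one such root. -/
theorem IsPosRoot.unique {R : Type u} [CommRing R] [IsDomain R] [Algebra ℝ R] {m : ℕ} (hm : m ≠ 0)
    {f g h : R⟦X⟧} (hg : IsPosRoot m f g) (hh : IsPosRoot m f h) : g = h := by
  obtain ⟨hg, c, hc, hgc⟩ := hg
  obtain ⟨hh, d, hd, hhd⟩ := hh
  have inj := FaithfulSMul.algebraMap_injective ℝ R
  have hcd : c = d := by
    have h1 : c ^ m = d ^ m := by
      apply inj
      rw [map_pow, map_pow, ← hgc, ← hhd, ← map_pow, ← map_pow, hg, hh]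
    exact (pow_left_inj₀ hc.le hd.le hm).1 h1
  subst hcd
  have key := (Commute.all g h).geom_sum₂_mul m
  rw [hg, hh, sub_self] at key
  rcases mul_eq_zero.1 key with h0 | h0
  · exfalso
    have := congrArg PowerSeries.constantCoeff h0
    simp only [map_sum, map_mul, map_pow, hgc, hhd, map_zero] at this
    rw [Finset.sum_congr rfl (g := fun _ => algebraMap ℝ R c ^ (m - 1))] at this
    · have h2 : algebraMap ℝ R (m * c ^ (m - 1)) = algebraMap ℝ R 0 := by
        simpa using this
      have h3 : (m : ℝ) * c ^ (m - 1) ≠ 0 := by positivity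
      exact h3 (inj h2)
    · intro i hi
      rw [← pow_add]
      congr 1
      have := Finset.mem_range.1 hi
      omega
  · exact sub_eq_zero.1 h0

/-! ### Algebraicity over the field of rational functions -/

/-- A field that contains the power series in `t` with coefficients in `k[x, 1/x, y, 1/y]`. -/
abbrev SeriesField (k : Type u) [Field k] : Type u := FractionRing ((Laurent₂ k)⟦X⟧)

/-- The embedding of the ring of power series into `SeriesField k`. -/
def toSeriesField (k : Type u) [Field k] (f : (Laurent₂ k)⟦X⟧) : SeriesField k :=
  algebraMap ((Laurent₂ k)⟦X⟧) (SeriesField k) f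

/-- The field `k(x, y, t)` of rational functions in `x`, `y` and `t`, as a subfield of
`SeriesField k`. -/
def rationalFunctions (k : Type u) [Field k] : IntermediateField k (SeriesField k) :=
  IntermediateField.adjoin k
    {toSeriesField k (PowerSeries.C (mon k 1 0)), toSeriesField k (PowerSeries.C (mon k 0 1)),
      toSeriesField k PowerSeries.X}

/-- The series `f` is algebraic of degree `d` over `k(x, y, t)`. -/
def IsAlgebraicOfDegree (k : Type u) [Field k] (f : (Laurent₂ k)⟦X⟧) (d : ℕ) : Prop :=
  IsAlgebraic (rationalFunctions k) (toSeriesField k f) ∧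
    (minpoly (rationalFunctions k) (toSeriesField k f)).natDegree = d

end

noncomputable section

/-! ### Roots of power series with constant term one -/

/-! The closed form comes from the kernel method. Put `K = (x + 1/x)(y + 1/y)`. Deleting the last
step shows that `S (1 - tK)` is supported on the forbidden half-line, hence is a series `ν` in `1/x`
and `t` (`exists_slitSeries_mul_eq`). The part of `S` free of `y` is a series `s` in `x` and `t`
with value 1 at `x = 0` (`exists_yFree_slitCoeff_eq`). Extracting this part from `S = ν / (1 - tK)`
gives `ν(1/x) / √(1 - 4t²(x + 1/x)²) = s(x)`. The radicand factors as `U(1/x)² E(x)²`, so `ν/U = sE`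
is both a series in `1/x` and a series in `x`. It is therefore free of `x` and equals its value 1 at
`x = 0`. Hence `ν = U`, whose square is explicit (`two_mul_slitSeries_mul_sq`).

For the degree, `Z = S (1 - tK)` is a root of a biquadratic `Z⁴ - AZ² + B`. Its discriminant `A² -
4B` and its constant term `B` are, up to squares, of the form `a (1 - c²t²)`. They are not squares
in `k(x, y, t)`, because `1/c` is a simple root, and the biquadratic is then irreducible.

For the asymptotics, put `w = 16t²`. At `x = y = 1` the series is `(1 + 4t) P(w) G(w)` with `P = (1
- w)^(-3/4)` and `G = ((1 + √(1 - w))/2)^(1/2)`. The coefficients of `P` are equivalent to `n^(-1/4)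
/ Γ(3/4)`, and those of `G` are `O(n^(-3/2))`. By dominated convergence the coefficients of `PG` are
equivalent to those of `P` times `G(1) = 2^(-1/2)`. -/

theorem PowerSeries.exists_pow_eq_of_constantCoeff_eq_one {A : Type*} [CommRing A] [Algebra ℚ A]
    {m : ℕ} (hm : m ≠ 0) {f : A⟦X⟧} (hf : PowerSeries.constantCoeff f = 1) :
    ∃ g : A⟦X⟧, g ^ m = f ∧ PowerSeries.constantCoeff g = 1 := by
  have hs : PowerSeries.HasSubst (f - 1) :=
    PowerSeries.HasSubst.of_constantCoeff_zero' (by simp [hf])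
  have hpow : ∀ j : ℕ, (PowerSeries.binomialSeries A (1 / m : ℚ)) ^ j =
      PowerSeries.binomialSeries A (j * (1 / m) : ℚ) := by
    intro j
    induction j with
    | zero => simp
    | succ j ih =>
      rw [pow_succ, ih, ← PowerSeries.binomialSeries_add]
      push_cast; ring_nf
  -- The root is `(1 + X)^(1/m)` evaluated at `X = f - 1`, which has zero constant term.
  refine ⟨(PowerSeries.binomialSeries A (1 / m : ℚ)).subst (f - 1), ?_, ?_⟩
  · rw [← PowerSeries.subst_pow hs, hpow, mul_one_div_cancel (by exact_mod_cast hm)]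
    have h1 : PowerSeries.binomialSeries A (1 : ℚ) = 1 + PowerSeries.X := by
      simpa using PowerSeries.binomialSeries_nat (A := A) (R := ℚ) 1
    rw [h1, PowerSeries.subst_add hs, PowerSeries.subst_X hs]
    rw [← PowerSeries.coe_substAlgHom hs, map_one]
    ring
  · have h2 : ∃ q : A⟦X⟧, PowerSeries.binomialSeries A (1 / m : ℚ) = 1 + PowerSeries.X * q := by
      have : PowerSeries.X ∣ PowerSeries.binomialSeries A (1 / m : ℚ) - 1 := by
        rw [PowerSeries.X_dvd_iff]; simp
      obtain ⟨q, hq⟩ := this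
      exact ⟨q, by rw [← hq]; ring⟩
    obtain ⟨q, hq⟩ := h2
    rw [hq, PowerSeries.subst_add hs, PowerSeries.subst_mul hs, PowerSeries.subst_X hs]
    rw [← PowerSeries.coe_substAlgHom hs, map_one]
    simp [hf]

/-- Identities between radicals are proved below by squaring. This removes the sign ambiguity: `f =
-g` would force `1 = -1`. -/
theorem PowerSeries.eq_of_sq_eq_sq {A : Type*} [CommRing A] [IsDomain A] [CharZero A]
    {f g : A⟦X⟧} (h : f ^ 2 = g ^ 2) (hf : PowerSeries.constantCoeff f = 1)
    (hg : PowerSeries.constantCoeff g = 1) : f = g := by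
  rcases sq_eq_sq_iff_eq_or_eq_neg.1 h with h | h
  · exact h
  · have := congrArg PowerSeries.constantCoeff h
    rw [map_neg, hf, hg] at this
    have h2 : (2 : A) = 0 := by linear_combination this
    exact absurd h2 two_ne_zero

theorem PowerSeries.exists_mul_eq_one {A : Type*} [CommRing A] {f : A⟦X⟧}
    (hf : PowerSeries.constantCoeff f = 1) :
    ∃ g : A⟦X⟧, f * g = 1 ∧ PowerSeries.constantCoeff g = 1 := by
  refine ⟨PowerSeries.invOfUnit f 1, PowerSeries.mul_invOfUnit f 1 (by simp [hf]), by simp⟩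

/-! ### The generating function of the central binomial coefficients -/

/-- The recurrence of the central binomial coefficients says `(1 - 4X) M' = 2M`, so `M² (1 - 4X)`
has derivative zero. -/
theorem PowerSeries.centralBinom_sq_mul (A : Type*) [Field A] [CharZero A] :
    (PowerSeries.mk (fun n => (n.centralBinom : A))) ^ 2 * (1 - 4 * PowerSeries.X) = 1 := by
  set M : A⟦X⟧ := PowerSeries.mk (fun n => (n.centralBinom : A)) with hM
  have hd : (1 - 4 * PowerSeries.X) * PowerSeries.derivative A M = 2 * M := by
    ext n
    have e : (1 - 4 * PowerSeries.X) * PowerSeries.derivative A M =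
      PowerSeries.derivative A M - PowerSeries.C (4 : A) *
        (PowerSeries.X * PowerSeries.derivative A M) := by
      rw [map_ofNat]; ring
    have e2 : 2 * M = PowerSeries.C (2 : A) * M := by rw [map_ofNat]
    rw [e, e2, map_sub, PowerSeries.coeff_C_mul, PowerSeries.coeff_C_mul,
      PowerSeries.coeff_derivative, hM, PowerSeries.coeff_mk, PowerSeries.coeff_mk]
    have key : ((n : A) + 1) * (n + 1).centralBinom = 2 * (2 * n + 1) * n.centralBinom := by
      exact_mod_cast Nat.succ_mul_centralBinom_succ n
    cases n with
    | zero =>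
      simp only [Nat.cast_zero, zero_add, mul_zero, mul_one, one_mul, Nat.centralBinom_zero,
        Nat.cast_one] at key ⊢
      simpa using key
    | succ n =>
      rw [PowerSeries.coeff_succ_X_mul, PowerSeries.coeff_derivative, PowerSeries.coeff_mk]
      push_cast at key ⊢
      linear_combination key
  apply PowerSeries.derivative.ext
  · simp only [Derivation.leibniz, Derivation.leibniz_pow, map_sub, PowerSeries.derivative_X,
      smul_eq_mul]
    have h4 : PowerSeries.derivative A (4 : A⟦X⟧) = 0 := by
      have := PowerSeries.derivative_C (R := A) (r := 4)
      rwa [map_ofNat] at this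
    rw [h4]
    simp
    linear_combination (2 * M) * hd
  · simp [hM]

/-! ### The recurrence for the numbers of walks -/

theorem finite_setOf_isSlitWalk (n : ℕ) : {w : Fin (n + 1) → ℤ × ℤ | IsSlitWalk n w}.Finite := by
  refine (Set.Finite.pi (t := fun _ : Fin (n + 1) =>
    (Set.Icc (-(n : ℤ)) n ×ˢ Set.Icc (-(n : ℤ)) n : Set (ℤ × ℤ)))
    fun _ => (Set.finite_Icc _ _).prod (Set.finite_Icc _ _)).subset ?_
  intro w hw
  simp only [Set.mem_pi, Set.mem_univ, forall_const, Set.mem_prod, Set.mem_Icc]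
  intro k
  have h := hw.coord_le k
  have hk := k.is_le
  simp only [abs_le] at h
  omega

theorem Set.Finite.ncard_eq_sum_ncard_fiber {α β : Type*} [DecidableEq β] {A : Set α}
    (hA : A.Finite) (f : α → β) (T : Finset β) (hf : ∀ a ∈ A, f a ∈ T) :
    A.ncard = ∑ t ∈ T, {a | a ∈ A ∧ f a = t}.ncard := by
  rw [Set.ncard_eq_toFinset_card A hA,
    Finset.card_eq_sum_card_fiberwise (f := f) (t := T) (by simpa [Set.MapsTo] using hf)]
  refine Finset.sum_congr rfl fun t _ => ?_
  rw [← Set.ncard_coe_finset]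
  congr 1
  ext a
  simp

/-- The diagonal steps as a finite set. -/
def diagonalStepsFinset : Finset (ℤ × ℤ) := {(1, 1), (1, -1), (-1, 1), (-1, -1)}

theorem mem_diagonalStepsFinset {s : ℤ × ℤ} : s ∈ diagonalStepsFinset ↔ s ∈ diagonalSteps := by
  simp [diagonalStepsFinset, diagonalSteps]

theorem isSlitWalk_snoc_iff {n : ℕ} {v : Fin (n + 1) → ℤ × ℤ} {p : ℤ × ℤ} :
    IsSlitWalk (n + 1) (Fin.snoc v p : Fin (n + 2) → ℤ × ℤ) ↔
      IsSlitWalk n v ∧ p - v (Fin.last n) ∈ diagonalSteps ∧ p ∉ halfLine := by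
  constructor
  · intro h
    refine ⟨⟨?_, fun k => ?_, fun k => ?_⟩, ?_, ?_⟩
    · have := h.start
      rwa [← Fin.castSucc_zero, Fin.snoc_castSucc] at this
    · have := h.step k.castSucc
      rwa [← Fin.castSucc_succ, Fin.snoc_castSucc, Fin.snoc_castSucc] at this
    · have := h.avoid k.castSucc
      rwa [← Fin.castSucc_succ, Fin.snoc_castSucc] at this
    · have := h.step (Fin.last n)
      rwa [Fin.succ_last, Fin.snoc_last, Fin.snoc_castSucc] at this
    · have := h.avoid (Fin.last n)
      rwa [Fin.succ_last, Fin.snoc_last] at this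
  · rintro ⟨h, h1, h2⟩
    refine ⟨?_, fun k => ?_, fun k => ?_⟩
    · rw [← Fin.castSucc_zero, Fin.snoc_castSucc]; exact h.start
    · refine Fin.lastCases ?_ (fun j => ?_) k
      · rwa [Fin.succ_last, Fin.snoc_last, Fin.snoc_castSucc]
      · rw [← Fin.castSucc_succ, Fin.snoc_castSucc, Fin.snoc_castSucc]; exact h.step j
    · refine Fin.lastCases ?_ (fun j => ?_) k
      · rwa [Fin.succ_last, Fin.snoc_last]
      · rw [← Fin.castSucc_succ, Fin.snoc_castSucc]; exact h.avoid j

theorem numWalksTo_succ_of_mem {n : ℕ} {p : ℤ × ℤ} (hp : p ∈ halfLine) :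
    numWalksTo (n + 1) p = 0 := by
  rw [numWalksTo, Set.ncard_eq_zero ((finite_setOf_isSlitWalk _).subset fun w hw => hw.1)]
  ext w
  simp only [Set.mem_ofPred_eq, Set.mem_empty_iff_false, iff_false, not_and]
  rintro h rfl
  exact h.avoid (Fin.last n) (by rwa [Fin.succ_last])

/-- Walks are sorted by their last step; deleting the last vertex is a bijection from each class
onto the shorter walks ending at `p - s`. -/
theorem numWalksTo_succ_of_notMem {n : ℕ} {p : ℤ × ℤ} (hp : p ∉ halfLine) :
    numWalksTo (n + 1) p = ∑ s ∈ diagonalStepsFinset, numWalksTo n (p - s) := by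
  have hfin : {w : Fin (n + 1 + 1) → ℤ × ℤ |
      IsSlitWalk (n + 1) w ∧ w (Fin.last (n + 1)) = p}.Finite :=
    (finite_setOf_isSlitWalk _).subset fun w hw => hw.1
  rw [numWalksTo, hfin.ncard_eq_sum_ncard_fiber (fun w => p - w (Fin.last n).castSucc)
    diagonalStepsFinset]
  · refine Finset.sum_congr rfl fun s hs => ?_
    symm
    refine Set.ncard_congr (fun v _ => (Fin.snoc v p : Fin (n + 2) → ℤ × ℤ)) ?_ ?_ ?_
    · rintro v ⟨hv, hl⟩
      have hsub : p - v (Fin.last n) = s := by rw [hl]; abel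
      refine ⟨⟨isSlitWalk_snoc_iff.2 ⟨hv, ?_, hp⟩, Fin.snoc_last _ _⟩, ?_⟩
      · rw [hsub]; exact mem_diagonalStepsFinset.1 hs
      · simpa only [Fin.snoc_castSucc] using hsub
    · intro v v' _ _ h
      have := congrArg Fin.init h
      simpa only [Fin.init_snoc] using this
    · rintro w ⟨⟨hw, hl⟩, hs'⟩
      have hw' : (Fin.snoc (Fin.init w) p : Fin (n + 2) → ℤ × ℤ) = w := by
        rw [← hl]; exact Fin.snoc_init_self w
      rw [← hw'] at hw
      refine ⟨Fin.init w, ⟨(isSlitWalk_snoc_iff.1 hw).1, ?_⟩, hw'⟩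
      rw [← hs']
      simp [Fin.init]
  · rintro w ⟨hw, hl⟩
    have := hw.step (Fin.last n)
    rw [Fin.succ_last, hl] at this
    exact mem_diagonalStepsFinset.2 this

theorem numWalksTo_zero (p : ℤ × ℤ) : numWalksTo 0 p = if p = 0 then 1 else 0 := by
  split_ifs with h
  · rw [numWalksTo, Set.ncard_eq_one]
    refine ⟨fun _ => (0, 0), ?_⟩
    ext w
    simp only [Set.mem_ofPred_eq, Set.mem_singleton_iff]
    constructor
    · rintro ⟨hw, -⟩
      ext k : 1
      have hk : k = 0 := Fin.ext (by omega)
      rw [hk]; exact hw.start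
    · rintro rfl
      exact ⟨⟨rfl, fun k => k.elim0, fun k => k.elim0⟩, h.symm⟩
  · by_contra h'
    have := mem_box_of_numWalksTo_ne_zero h'
    simp only [Finset.mem_product, Finset.mem_Icc] at this
    apply h
    ext <;> simp <;> omega

theorem numWalks_eq_sum (n : ℕ) :
    numWalks n = ∑ p ∈ Finset.Icc (-(n : ℤ)) n ×ˢ Finset.Icc (-(n : ℤ)) n, numWalksTo n p := by
  rw [numWalks, (finite_setOf_isSlitWalk n).ncard_eq_sum_ncard_fiber (fun w => w (Fin.last n))]
  · rfl
  · intro w hw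
    have := IsSlitWalk.coord_le hw (Fin.last n)
    simpa [abs_le] using this

/-! ### The functional equation -/

section Ring

variable {R : Type u} [CommRing R]

theorem coeff_slitCoeff (n : ℕ) (p : ℤ × ℤ) :
    (slitCoeff R n).coeff p = (numWalksTo n p : R) := rfl

theorem coeff_mon_mul (i j : ℤ) (f : Laurent₂ R) (p : ℤ × ℤ) :
    (mon R i j * f).coeff p = f.coeff (p - (i, j)) := by
  rw [mon, AddMonoidAlgebra.coeff_single_mul_apply]
  simp [sub_eq_neg_add]

theorem mon_mul_mon (i j i' j' : ℤ) : mon R i j * mon R i' j' = mon R (i + i') (j + j') := by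
  simp [mon, AddMonoidAlgebra.single_mul_single]

theorem mon_zero_zero : mon R 0 0 = 1 := rfl

theorem mon_pow (i j : ℤ) (n : ℕ) : mon R i j ^ n = mon R (n * i) (n * j) := by
  simp [mon, AddMonoidAlgebra.single_pow]

/-- The sum of the monomials of the four diagonal steps. -/
def stepPoly (R : Type u) [CommRing R] : Laurent₂ R :=
  (mon R 1 0 + mon R (-1) 0) * (mon R 0 1 + mon R 0 (-1))

theorem stepPoly_eq : stepPoly R = ∑ s ∈ diagonalStepsFinset, mon R s.1 s.2 := by
  rw [diagonalStepsFinset, Finset.sum_insert (by simp), Finset.sum_insert (by simp),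
    Finset.sum_insert (by simp), Finset.sum_singleton, stepPoly, add_mul, mul_add, mul_add]
  simp only [mon_mul_mon]
  norm_num
  ring

theorem coeff_stepPoly_mul (f : Laurent₂ R) (p : ℤ × ℤ) :
    (stepPoly R * f).coeff p = ∑ s ∈ diagonalStepsFinset, f.coeff (p - s) := by
  rw [stepPoly_eq, Finset.sum_mul, AddMonoidAlgebra.coeff_sum, Finset.sum_apply']
  exact Finset.sum_congr rfl fun s _ => coeff_mon_mul _ _ _ _

theorem slitCoeff_zero : slitCoeff R 0 = 1 := by
  ext p
  rw [coeff_slitCoeff, numWalksTo_zero, ← mon_zero_zero, mon, AddMonoidAlgebra.coeff_single,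
    Finsupp.single_apply]
  simp [eq_comm, Prod.zero_eq_mk]

theorem coeff_slitCoeff_succ_of_mem {n : ℕ} {p : ℤ × ℤ} (hp : p ∈ halfLine) :
    (slitCoeff R (n + 1)).coeff p = 0 := by
  rw [coeff_slitCoeff, numWalksTo_succ_of_mem hp, Nat.cast_zero]

theorem coeff_slitCoeff_succ_of_notMem {n : ℕ} {p : ℤ × ℤ} (hp : p ∉ halfLine) :
    (slitCoeff R (n + 1)).coeff p = (stepPoly R * slitCoeff R n).coeff p := by
  rw [coeff_slitCoeff, numWalksTo_succ_of_notMem hp, coeff_stepPoly_mul, Nat.cast_sum]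
  rfl

/-! ### Laurent polynomials in `x` with exponents of one sign -/

/-- The substitution of `x ^ e` for the variable of a polynomial. -/
def substX (R : Type u) [CommRing R] (e : ℤ) : Polynomial R →ₐ[R] Laurent₂ R :=
  Polynomial.aeval (mon R e 0)

theorem substX_monomial (e : ℤ) (n : ℕ) (a : R) :
    substX R e (Polynomial.monomial n a) = AddMonoidAlgebra.single (n * e, 0) a := by
  rw [substX, Polynomial.aeval_monomial, mon_pow, mon]
  rw [← Algebra.smul_def, AddMonoidAlgebra.smul_single]
  simp

/-- The hypothesis `e * e = 1` means `e = ±1`, so series in `x` and in `1/x` are treated together;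
the solution of `n * e = a` is `n = e * a`. -/
theorem coeff_substX {e : ℤ} (he : e * e = 1) (p : Polynomial R) (a b : ℤ) :
    (substX R e p).coeff (a, b) = if b = 0 ∧ 0 ≤ e * a then p.coeff (e * a).toNat else 0 := by
  induction p using Polynomial.induction_on' with
  | add p q hp hq =>
    rw [map_add, AddMonoidAlgebra.coeff_add, Finsupp.add_apply, hp, hq, Polynomial.coeff_add]
    split_ifs <;> simp
  | monomial n r =>
    rw [substX_monomial, AddMonoidAlgebra.coeff_single, Finsupp.single_apply,
      Polynomial.coeff_monomial]
    have : ((n : ℤ) * e, (0 : ℤ)) = (a, b) ↔ (b = 0 ∧ 0 ≤ e * a) ∧ n = (e * a).toNat := by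
      rw [Prod.mk.injEq]
      have key : (n : ℤ) * e = a ↔ (n : ℤ) = e * a := by
        constructor
        · rintro rfl; linear_combination (-(n : ℤ)) * he
        · intro h; rw [h]; linear_combination a * he
      rw [key]
      omega
    by_cases h1 : b = 0 ∧ 0 ≤ e * a
    · by_cases h2 : n = (e * a).toNat
      · rw [if_pos (this.2 ⟨h1, h2⟩), if_pos h1, if_pos h2]
      · rw [if_neg (fun h => h2 (this.1 h).2), if_pos h1, if_neg h2]
    · rw [if_neg (fun h => h1 (this.1 h).1), if_neg h1]

theorem coeff_zero_substX {e : ℤ} (he : e * e = 1) (p : Polynomial R) :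
    (substX R e p).coeff (0, 0) = p.coeff 0 := by
  simp [coeff_substX he]

theorem mem_range_substX {e : ℤ} (he : e * e = 1) {f : Laurent₂ R}
    (hf : ∀ p, f.coeff p ≠ 0 → p.2 = 0 ∧ 0 ≤ e * p.1) : f ∈ (substX R e).range := by
  rw [← AddMonoidAlgebra.sum_coeff_single f]
  refine Subalgebra.sum_mem _ fun p hp => ?_
  obtain ⟨h1, h2⟩ := hf p (Finsupp.mem_support_iff.1 hp)
  refine ⟨Polynomial.monomial (e * p.1).toNat (f.coeff p), ?_⟩
  change substX R e _ = _
  rw [substX_monomial, Int.toNat_of_nonneg h2]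
  congr 1
  ext
  · change e * p.1 * e = p.1
    linear_combination p.1 * he
  · exact h1.symm

/-- The separation step of the kernel method: exponents that are both nonpositive and nonnegative
are zero. -/
theorem eq_C_of_substX_eq {p q : Polynomial R} (h : substX R (-1) p = substX R 1 q) :
    q = Polynomial.C (q.coeff 0) := by
  ext n
  rw [Polynomial.coeff_C]
  split_ifs with hn
  · rw [hn]
  · have h1 := coeff_substX (R := R) (e := 1) (by norm_num) q n 0
    rw [← h, coeff_substX (by norm_num), if_neg (by omega), if_pos (by omega)] at h1
    simpa using h1.symm

/-! ### Extraction of the part free of `y` -/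

/-- The part of a Laurent polynomial that does not involve `y`. -/
def yFree (R : Type u) [CommRing R] : Laurent₂ R →+ Laurent₂ R where
  toFun f := AddMonoidAlgebra.ofCoeff (f.coeff.filter fun p => p.2 = 0)
  map_zero' := by ext; simp [Finsupp.filter_zero]
  map_add' f g := by ext; simp [Finsupp.filter_add]

theorem coeff_yFree (f : Laurent₂ R) (p : ℤ × ℤ) :
    (yFree R f).coeff p = if p.2 = 0 then f.coeff p else 0 := by
  change (Finsupp.filter _ _) p = _
  rw [Finsupp.filter_apply]

theorem yFree_single_mul (i : ℤ) (a : R) (f : Laurent₂ R) :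
    yFree R (AddMonoidAlgebra.single (i, 0) a * f) =
      AddMonoidAlgebra.single (i, 0) a * yFree R f := by
  ext p
  simp [coeff_yFree, AddMonoidAlgebra.coeff_single_mul_apply]

/-- Factors in `x` alone leave the exponents of `y` unchanged; this lets `ν` be pulled out of the
extraction. -/
theorem yFree_substX_mul (e : ℤ) (p : Polynomial R) (f : Laurent₂ R) :
    yFree R (substX R e p * f) = substX R e p * yFree R f := by
  induction p using Polynomial.induction_on' with
  | add p q hp hq => rw [map_add, add_mul, map_add, hp, hq, add_mul]
  | monomial n a => rw [substX_monomial, yFree_single_mul]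

theorem yFree_pow_mul (n : ℕ) (f : Laurent₂ R) :
    yFree R ((mon R 1 0 + mon R (-1) 0) ^ n * f) =
      (mon R 1 0 + mon R (-1) 0) ^ n * yFree R f := by
  induction n with
  | zero => simp
  | succ n ih =>
    rw [pow_succ', mul_assoc, add_mul, map_add]
    simp only [mon] at ih ⊢
    rw [yFree_single_mul, yFree_single_mul, ih]
    ring

theorem yFree_mon (i j : ℤ) : yFree R (mon R i j) = if j = 0 then mon R i j else 0 := by
  ext p
  rw [coeff_yFree]
  split_ifs with h1 h2 h2
  · rfl
  · rw [mon, AddMonoidAlgebra.coeff_single, Finsupp.single_apply, if_neg]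
    · rfl
    · rintro rfl; exact h2 h1
  · rw [mon, AddMonoidAlgebra.coeff_single, Finsupp.single_apply, if_neg]
    rintro rfl; exact h1 h2
  · rfl

/-- In the binomial expansion, `y^k y^(-(n - k))` is free of `y` only for the middle index `2k = n`.
-/
theorem yFree_pow (n : ℕ) :
    yFree R ((mon R 0 1 + mon R 0 (-1)) ^ n) =
      if 2 ∣ n then ((n / 2).centralBinom : Laurent₂ R) else 0 := by
  rw [add_pow, map_sum]
  have hterm : ∀ k ∈ Finset.range (n + 1),
      yFree R (mon R 0 1 ^ k * mon R 0 (-1) ^ (n - k) * (n.choose k : Laurent₂ R)) =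
        if 2 * k = n then (n.choose k : Laurent₂ R) else 0 := by
    intro k hk
    have hk' : k ≤ n := Nat.lt_succ_iff.1 (Finset.mem_range.1 hk)
    rw [← nsmul_eq_mul', map_nsmul, mon_pow, mon_pow, mon_mul_mon, yFree_mon]
    have : ((k : ℤ) * 1 + ((n - k : ℕ) : ℤ) * -1 = 0) ↔ 2 * k = n := by omega
    rw [if_congr this rfl rfl]
    split_ifs with h
    · have h0 : (k : ℤ) * 1 + ((n - k : ℕ) : ℤ) * -1 = 0 := this.2 h
      rw [h0]
      simp [mon_zero_zero]
    · simp
  rw [Finset.sum_congr rfl hterm]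
  split_ifs with h
  · obtain ⟨m, rfl⟩ := h
    rw [Finset.sum_eq_single m]
    · simp [Nat.centralBinom]
    · intro k _ hk
      rw [if_neg (by omega)]
    · intro hm
      exact absurd (Finset.mem_range.2 (by omega)) hm
  · refine Finset.sum_eq_zero fun k _ => if_neg ?_
    rintro rfl
    exact h ⟨k, rfl⟩

/-! ### Supports of the two sides of the functional equation -/

theorem exists_slitSeries_mul_eq :
    ∃ ν : (Polynomial R)⟦X⟧,
      slitSeries R * (1 - PowerSeries.X * PowerSeries.C (stepPoly R)) =
        PowerSeries.map (substX R (-1)).toRingHom ν := by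
  have h : ∀ n, ∃ p : Polynomial R,
      substX R (-1) p = slitCoeff R (n + 1) - stepPoly R * slitCoeff R n := by
    intro n
    refine mem_range_substX (by norm_num) fun p hp => ?_
    have : p ∈ halfLine := by
      by_contra h'
      apply hp
      rw [AddMonoidAlgebra.coeff_sub, Finsupp.sub_apply, coeff_slitCoeff_succ_of_notMem h',
        sub_self]
    obtain ⟨h1, h2⟩ := this
    exact ⟨h2, by omega⟩
  choose p hp using h
  -- The coefficient of `t^0` is 1, from the empty walk; `p n` belongs to `t^(n + 1)`.
  refine ⟨PowerSeries.mk fun n => Nat.casesOn n 1 p, ?_⟩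
  ext1 n
  rw [PowerSeries.coeff_map, PowerSeries.coeff_mk]
  have e : slitSeries R * (1 - PowerSeries.X * PowerSeries.C (stepPoly R)) =
    slitSeries R - PowerSeries.X * (PowerSeries.C (stepPoly R) * slitSeries R) := by ring
  rw [e, map_sub]
  cases n with
  | zero => simp [slitSeries, slitCoeff_zero]
  | succ n =>
    rw [PowerSeries.coeff_succ_X_mul, PowerSeries.coeff_C_mul]
    simp only [slitSeries, PowerSeries.coeff_mk]
    exact (hp n).symm

/-- A nonempty walk that ends on the horizontal axis ends at a positive abscissa, so only the empty
walk contributes to `x^0`. -/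
theorem exists_yFree_slitCoeff_eq :
    ∃ s : (Polynomial R)⟦X⟧, PowerSeries.map Polynomial.constantCoeff s = 1 ∧
      ∀ n, yFree R (slitCoeff R n) = substX R 1 (PowerSeries.coeff n s) := by
  have h : ∀ n, ∃ p : Polynomial R, substX R 1 p = yFree R (slitCoeff R n) := by
    intro n
    refine mem_range_substX (by norm_num) fun p hp => ?_
    rw [coeff_yFree] at hp
    split_ifs at hp with h2
    · refine ⟨h2, ?_⟩
      by_contra h3
      have hmem : p ∈ halfLine := ⟨by omega, h2⟩
      cases n with
      | zero =>
        rw [coeff_slitCoeff, numWalksTo_zero, if_neg] at hp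
        · simp at hp
        · rintro rfl; simp at h3
      | succ n => exact hp (coeff_slitCoeff_succ_of_mem hmem)
    · exact absurd rfl hp
  choose p hp using h
  refine ⟨PowerSeries.mk p, ?_, fun n => by rw [PowerSeries.coeff_mk, hp]⟩
  ext n
  rw [PowerSeries.coeff_map, PowerSeries.coeff_mk, Polynomial.constantCoeff_apply,
    ← coeff_zero_substX (e := 1) (by norm_num), hp, coeff_yFree, if_pos rfl,
    PowerSeries.coeff_one]
  cases n with
  | zero => simp [slitCoeff_zero, AddMonoidAlgebra.one_def, Prod.zero_eq_mk]
  | succ n =>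
    rw [coeff_slitCoeff_succ_of_mem ⟨le_refl _, rfl⟩]
    simp

end Ring

/-! ### The kernel method -/

section Kernel

variable {k : Type u} [Field k]

instance laurent₂_charZero [CharZero k] : CharZero (Laurent₂ k) :=
  charZero_of_injective_algebraMap (algebraMap k (Laurent₂ k)).injective

theorem PowerSeries.map_ofNat_mul_X_pow {A B : Type*} [CommRing A] [CommRing B] (φ : A →+* B)
    (a : ℕ) [a.AtLeastTwo] (n : ℕ) :
    PowerSeries.map φ (OfNat.ofNat a * PowerSeries.X ^ n) = OfNat.ofNat a * PowerSeries.X ^ n := by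
  rw [map_mul, map_pow, PowerSeries.map_X, map_ofNat]

theorem PowerSeries.constantCoeff_map_apply {A B : Type*} [CommRing A] [CommRing B] (φ : A →+* B)
    (f : A⟦X⟧) : PowerSeries.constantCoeff (PowerSeries.map φ f) =
      φ (PowerSeries.constantCoeff f) := by
  rw [← PowerSeries.coeff_zero_eq_constantCoeff_apply, PowerSeries.coeff_map,
    PowerSeries.coeff_zero_eq_constantCoeff_apply]

theorem map_substX_map_C (e : ℤ) (f : k⟦X⟧) :
    PowerSeries.map (substX k e).toRingHom (PowerSeries.map Polynomial.C f) =
      PowerSeries.map (algebraMap k (Laurent₂ k)) f := by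
  ext1 n
  rw [PowerSeries.coeff_map, PowerSeries.coeff_map, PowerSeries.coeff_map]
  exact (substX k e).commutes _

theorem map_substX_C_X_sq (e : ℤ) :
    PowerSeries.map (substX k e).toRingHom (PowerSeries.C (Polynomial.X ^ 2)) =
      PowerSeries.C (mon k e 0 ^ 2) := by
  rw [PowerSeries.map_C]
  simp [substX]

/-- The part of `1 / (1 - t (x + 1/x) (y + 1/y))` that does not involve `y`. -/
def kernelYFree (k : Type u) [Field k] : (Laurent₂ k)⟦X⟧ :=
  PowerSeries.rescale (mon k 1 0 + mon k (-1) 0) (PowerSeries.map (algebraMap k (Laurent₂ k))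
    (PowerSeries.expand 2 two_ne_zero (PowerSeries.mk fun n => (n.centralBinom : k))))

theorem coeff_kernelYFree (n : ℕ) :
    PowerSeries.coeff n (kernelYFree k) = yFree k (stepPoly k ^ n) := by
  rw [kernelYFree, PowerSeries.coeff_rescale, PowerSeries.coeff_map, PowerSeries.coeff_expand,
    stepPoly, mul_pow, yFree_pow_mul, yFree_pow]
  congr 1
  split_ifs <;> simp

theorem kernelYFree_sq_mul [CharZero k] :
    kernelYFree k ^ 2 * (1 - 4 * PowerSeries.X ^ 2 *
      PowerSeries.C ((mon k 1 0 + mon k (-1) 0) ^ 2)) = 1 := by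
  have h := congrArg (fun f => PowerSeries.rescale (mon k 1 0 + mon k (-1) 0)
    (PowerSeries.map (algebraMap k (Laurent₂ k)) (PowerSeries.expand 2 two_ne_zero f)))
    (PowerSeries.centralBinom_sq_mul k)
  simp only [map_mul, map_sub, map_one, map_pow, PowerSeries.expand_X, PowerSeries.map_X,
    map_ofNat, PowerSeries.rescale_X] at h
  refine Eq.trans ?_ h
  rw [kernelYFree]
  simp only [map_pow]
  ring

theorem constantCoeff_kernelYFree : PowerSeries.constantCoeff (kernelYFree k) = 1 := by
  rw [← PowerSeries.coeff_zero_eq_constantCoeff_apply, coeff_kernelYFree, pow_zero,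
    ← mon_zero_zero, yFree_mon, if_pos rfl]

theorem PowerSeries.one_sub_X_mul_C_mul_mk_pow {A : Type*} [CommRing A] (a : A) :
    (1 - PowerSeries.X * PowerSeries.C a) * PowerSeries.mk (fun n => a ^ n) = 1 := by
  have h2 := congrArg (PowerSeries.rescale a) (PowerSeries.mk_one_mul_one_sub_eq_one A)
  have h3 : PowerSeries.rescale a (PowerSeries.mk 1) = PowerSeries.mk (fun n => a ^ n) := by
    ext1 n; simp [PowerSeries.coeff_rescale]
  rw [map_mul, map_sub, map_one, PowerSeries.rescale_X, h3] at h2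
  linear_combination h2

/-- Expand `S = ν ∑ tⁿ Kⁿ` and take the part free of `y`; it passes through `ν`, which involves only
`1/x` and `t`. -/
theorem mul_kernelYFree_eq {ν s : (Polynomial k)⟦X⟧}
    (hν : slitSeries k * (1 - PowerSeries.X * PowerSeries.C (stepPoly k)) =
      PowerSeries.map (substX k (-1)).toRingHom ν)
    (hs : ∀ n, yFree k (slitCoeff k n) = substX k 1 (PowerSeries.coeff n s)) :
    PowerSeries.map (substX k (-1)).toRingHom ν * kernelYFree k =
      PowerSeries.map (substX k 1).toRingHom s := by
  have hS : slitSeries k = PowerSeries.map (substX k (-1)).toRingHom ν *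
      PowerSeries.mk (fun n => stepPoly k ^ n) := by
    rw [← hν, mul_assoc, PowerSeries.one_sub_X_mul_C_mul_mk_pow, mul_one]
  ext1 n
  rw [PowerSeries.coeff_map]
  change _ = substX k 1 _
  rw [← hs]
  have hc : slitCoeff k n = PowerSeries.coeff n (slitSeries k) := by
    rw [slitSeries, PowerSeries.coeff_mk]
  rw [hc, hS, PowerSeries.coeff_mul, PowerSeries.coeff_mul, map_sum]
  refine Finset.sum_congr rfl fun ij _ => ?_
  rw [PowerSeries.coeff_map, PowerSeries.coeff_mk, coeff_kernelYFree]
  exact (yFree_substX_mul _ _ _).symm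

/-- The closed form of the complete generating function, over any field of characteristic zero. -/
theorem two_mul_slitSeries_mul_sq [CharZero k] {ρ : k⟦X⟧} (hρ : ρ ^ 2 = 1 - 16 * PowerSeries.X ^ 2)
    (hρ1 : PowerSeries.constantCoeff ρ = 1) :
    2 * (slitSeries k * (1 - PowerSeries.X * PowerSeries.C (stepPoly k))) ^ 2 =
      1 - 8 * PowerSeries.X ^ 2 * (1 + PowerSeries.C (mon k (-1) 0 ^ 2)) +
        PowerSeries.map (algebraMap k (Laurent₂ k)) ρ := by
  have hX : PowerSeries.constantCoeff (PowerSeries.X : k⟦X⟧) = 0 := PowerSeries.constantCoeff_X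
  -- the factorization `1 - 4 t² (x + 1/x)² = δ (1 - α x²) (1 - α x⁻²)`
  obtain ⟨δ, hδ⟩ : ∃ δ : k⟦X⟧, 2 * δ = 1 - 8 * PowerSeries.X ^ 2 + ρ := by
    refine ⟨PowerSeries.C (1 / 2) * (1 - 8 * PowerSeries.X ^ 2 + ρ), ?_⟩
    have : (2 : k⟦X⟧) * PowerSeries.C (1 / 2) = 1 := by
      rw [← map_ofNat PowerSeries.C 2, ← map_mul]; simp
    rw [← mul_assoc, this, one_mul]
  have hδ1 : PowerSeries.constantCoeff δ = 1 := by
    have h := congrArg PowerSeries.constantCoeff hδ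
    simp only [map_mul, map_add, map_sub, map_pow, map_one, hX, hρ1, map_ofNat] at h
    have h2 : (2 : k) * PowerSeries.constantCoeff δ = 2 * 1 := by rw [h]; norm_num
    exact mul_left_cancel₀ two_ne_zero h2
  -- Matching the coefficients of `x^0` and `x^(±2)` in the factorization requires `δ(1 + α²) = 1 -
  -- 8t²` and `δα = 4t²`. Eliminating `α = 4t²/δ` leaves this quadratic equation for `δ`.
  have hδ2 : δ ^ 2 + 16 * PowerSeries.X ^ 4 = (1 - 8 * PowerSeries.X ^ 2) * δ := by
    have h4 : (4 : k⟦X⟧) ≠ 0 := by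
      rw [← map_ofNat PowerSeries.C 4]
      simp
    refine mul_left_cancel₀ h4 ?_
    linear_combination (2 * δ - (1 - 8 * PowerSeries.X ^ 2) + ρ) * hδ + hρ
  obtain ⟨δ', hδ', -⟩ := PowerSeries.exists_mul_eq_one hδ1
  obtain ⟨α, hα⟩ : ∃ α : k⟦X⟧, α = 4 * PowerSeries.X ^ 2 * δ' := ⟨_, rfl⟩
  have hα1 : δ * α = 4 * PowerSeries.X ^ 2 := by
    rw [hα]; linear_combination (4 * PowerSeries.X ^ 2) * hδ'
  have hα2 : δ + 4 * PowerSeries.X ^ 2 * α = 1 - 8 * PowerSeries.X ^ 2 := by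
    rw [hα]
    linear_combination δ' * hδ2 + (1 - 8 * PowerSeries.X ^ 2 - δ) * hδ'
  have hα0 : PowerSeries.constantCoeff α = 0 := by rw [hα]; simp
  -- Here `u² = δ(1 - αX²)`, to be read with `X = 1/x`, and below `e² = 1 - αX²`, to be read with `X
  -- = x`.
  obtain ⟨u, hu, hu1⟩ := PowerSeries.exists_pow_eq_of_constantCoeff_eq_one two_ne_zero
    (f := PowerSeries.map Polynomial.C δ - 4 * PowerSeries.X ^ 2 *
      PowerSeries.C (Polynomial.X ^ 2 : Polynomial k))
    (by simp [PowerSeries.constantCoeff_map_apply, hδ1])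
  obtain ⟨e, he, he1⟩ := PowerSeries.exists_pow_eq_of_constantCoeff_eq_one two_ne_zero
    (f := 1 - PowerSeries.map Polynomial.C α * PowerSeries.C (Polynomial.X ^ 2 : Polynomial k))
    (by simp [PowerSeries.constantCoeff_map_apply, hα0])
  have he0 : PowerSeries.map Polynomial.constantCoeff e = 1 := by
    refine PowerSeries.eq_of_sq_eq_sq ?_
      (by rw [PowerSeries.constantCoeff_map_apply, he1, map_one]) (by simp)
    rw [← map_pow, he]
    simp only [map_sub, map_one, map_mul, PowerSeries.map_C]
    simp
  obtain ⟨ν, hν⟩ := exists_slitSeries_mul_eq (R := k)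
  obtain ⟨s, hs1, hs⟩ := exists_yFree_slitCoeff_eq (R := k)
  have hNM := mul_kernelYFree_eq hν hs
  have hxx : PowerSeries.C (mon k (-1) 0) * PowerSeries.C (mon k 1 0) = 1 := by
    rw [← map_mul, mon_mul_mon]; norm_num [mon_zero_zero]
  have hU : PowerSeries.map (substX k (-1)).toRingHom u ^ 2 =
      PowerSeries.map (algebraMap k (Laurent₂ k)) δ -
        4 * PowerSeries.X ^ 2 * PowerSeries.C (mon k (-1) 0 ^ 2) := by
    rw [← map_pow, hu, map_sub, map_mul, map_substX_map_C, map_substX_C_X_sq,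
      PowerSeries.map_ofNat_mul_X_pow]
  have hE : PowerSeries.map (substX k 1).toRingHom e ^ 2 =
      1 - PowerSeries.map (algebraMap k (Laurent₂ k)) α * PowerSeries.C (mon k 1 0 ^ 2) := by
    rw [← map_pow, he, map_sub, map_mul, map_one, map_substX_map_C, map_substX_C_X_sq]
  have hα1' := congrArg (PowerSeries.map (algebraMap k (Laurent₂ k))) hα1
  have hα2' := congrArg (PowerSeries.map (algebraMap k (Laurent₂ k))) hα2
  have hδ' := congrArg (PowerSeries.map (algebraMap k (Laurent₂ k))) hδ
  simp only [map_add, map_mul, map_sub, map_one, map_pow, PowerSeries.map_X, map_ofNat]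
    at hα1' hα2' hδ'
  have hUE : (PowerSeries.map (substX k (-1)).toRingHom u *
      PowerSeries.map (substX k 1).toRingHom e) ^ 2 = 1 - 4 * PowerSeries.X ^ 2 *
      PowerSeries.C ((mon k 1 0 + mon k (-1) 0) ^ 2) := by
    rw [mul_pow, hU, hE]
    simp only [map_pow, map_add]
    linear_combination hα2' - PowerSeries.C (mon k 1 0) ^ 2 * hα1' +
      (PowerSeries.map (algebraMap k (Laurent₂ k)) α * 4 * PowerSeries.X ^ 2 *
        (PowerSeries.C (mon k (-1) 0) * PowerSeries.C (mon k 1 0) + 1) +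
        8 * PowerSeries.X ^ 2) * hxx
  have hone : kernelYFree k * (PowerSeries.map (substX k (-1)).toRingHom u *
      PowerSeries.map (substX k 1).toRingHom e) = 1 := by
    refine PowerSeries.eq_of_sq_eq_sq ?_ ?_ (by simp)
    · rw [mul_pow, hUE, kernelYFree_sq_mul, one_pow]
    · rw [map_mul, map_mul, PowerSeries.constantCoeff_map_apply,
        PowerSeries.constantCoeff_map_apply, hu1, he1, constantCoeff_kernelYFree]
      simp only [map_one, mul_one]
  obtain ⟨u', huu', -⟩ := PowerSeries.exists_mul_eq_one hu1
  -- The variables are separated: `ν/u` involves only `1/x`, and `s e` only `x`.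
  have hNu : PowerSeries.map (substX k (-1)).toRingHom (ν * u') =
      PowerSeries.map (substX k 1).toRingHom (s * e) := by
    have h1 := congrArg (PowerSeries.map (substX k (-1)).toRingHom) huu'
    rw [map_mul, map_one] at h1
    rw [map_mul, map_mul, ← hNM]
    linear_combination (-(PowerSeries.map (substX k (-1)).toRingHom ν *
        PowerSeries.map (substX k (-1)).toRingHom u')) * hone +
      (kernelYFree k * PowerSeries.map (substX k (-1)).toRingHom ν *
        PowerSeries.map (substX k 1).toRingHom e) * h1
  -- Each coefficient of `s e` is constant in `x`, hence determined by its value at `x = 0`.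
  have hse : s * e = 1 := by
    have h0 : PowerSeries.map Polynomial.constantCoeff (s * e) = 1 := by
      rw [map_mul, hs1, he0, one_mul]
    ext1 n
    have h1 := congrArg (PowerSeries.coeff n) hNu
    rw [PowerSeries.coeff_map, PowerSeries.coeff_map] at h1
    have h2 := congrArg (PowerSeries.coeff n) h0
    rw [PowerSeries.coeff_map, Polynomial.constantCoeff_apply, PowerSeries.coeff_one] at h2
    rw [eq_C_of_substX_eq h1, h2, PowerSeries.coeff_one]
    split_ifs <;> simp
  have hfin : PowerSeries.map (substX k (-1)).toRingHom ν =
      PowerSeries.map (substX k (-1)).toRingHom u := by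
    have h1 := congrArg (PowerSeries.map (substX k 1).toRingHom) hse
    rw [map_mul, map_one, ← hNM] at h1
    linear_combination PowerSeries.map (substX k (-1)).toRingHom u * h1 -
      PowerSeries.map (substX k (-1)).toRingHom ν * hone
  rw [hν, hfin, hU]
  linear_combination hδ'

theorem constantCoeff_slitSeries_mul {R : Type u} [CommRing R] :
    PowerSeries.constantCoeff
      (slitSeries R * (1 - PowerSeries.X * PowerSeries.C (stepPoly R))) = 1 := by
  simp only [map_mul, map_sub, map_one, PowerSeries.constantCoeff_X, zero_mul, sub_zero, mul_one]
  rw [slitSeries, ← PowerSeries.coeff_zero_eq_constantCoeff_apply, PowerSeries.coeff_mk,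
    slitCoeff_zero]

end Kernel

/-- The closed form of the complete generating function over the real numbers. -/
theorem slitSeries_real_closed_form :
    ∃ ρ σ : (Laurent₂ ℝ)⟦X⟧,
      IsPosRoot 2 (1 - 16 * PowerSeries.X ^ 2) ρ ∧
      IsPosRoot 2
        (1 - 8 * PowerSeries.X ^ 2 * (1 + PowerSeries.C (mon ℝ (-1) 0 ^ 2)) + ρ) σ ∧
      slitSeries ℝ *
        (PowerSeries.C (algebraMap ℝ (Laurent₂ ℝ) (Real.sqrt 2)) *
          (1 - PowerSeries.X *
            PowerSeries.C ((mon ℝ 1 0 + mon ℝ (-1) 0) * (mon ℝ 0 1 + mon ℝ 0 (-1))))) = σ := by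
  obtain ⟨ρ, hρ, hρ1⟩ := PowerSeries.exists_pow_eq_of_constantCoeff_eq_one two_ne_zero
    (f := (1 - 16 * PowerSeries.X ^ 2 : ℝ⟦X⟧)) (by simp)
  have hmain := two_mul_slitSeries_mul_sq hρ hρ1
  have h1 := constantCoeff_slitSeries_mul (R := ℝ)
  refine ⟨PowerSeries.map (algebraMap ℝ (Laurent₂ ℝ)) ρ, _, ⟨?_, 1, one_pos, ?_⟩,
    ⟨?_, Real.sqrt 2, by positivity, ?_⟩, rfl⟩
  · rw [← map_pow, hρ, map_sub, map_one, PowerSeries.map_ofNat_mul_X_pow]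
  · rw [PowerSeries.constantCoeff_map_apply, hρ1, map_one]
  · rw [← hmain, stepPoly]
    have h2 : (PowerSeries.C (algebraMap ℝ (Laurent₂ ℝ) (Real.sqrt 2))) ^ 2 = 2 := by
      rw [← map_pow, ← map_pow, Real.sq_sqrt (by norm_num), map_ofNat, map_ofNat]
    linear_combination (slitSeries ℝ * (1 - PowerSeries.X *
      PowerSeries.C ((mon ℝ 1 0 + mon ℝ (-1) 0) * (mon ℝ 0 1 + mon ℝ 0 (-1))))) ^ 2 * h2
  · rw [mul_left_comm, map_mul, PowerSeries.constantCoeff_C]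
    rw [stepPoly] at h1
    rw [h1, mul_one]

/-! ### Biquadratic polynomials -/

/-- A root `r` gives `(2r² - a)² = a² - 4b`. In a product of two monic quadratics the vanishing
cubic term makes the linear coefficients `c` and `-c`, and the vanishing linear term gives `c (d' -
d) = 0`. If `c = 0` then `a² - 4b = (d - d')²`; if `d = d'` then `b = d²`. -/
theorem irreducible_biquadratic {K : Type*} [Field K] {a b : K}
    (h1 : ¬ IsSquare (a ^ 2 - 4 * b)) (h2 : ¬ IsSquare b) :
    Irreducible (Polynomial.X ^ 4 - Polynomial.C a * Polynomial.X ^ 2 + Polynomial.C b) := by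
  have hdeg : (Polynomial.X ^ 4 - Polynomial.C a * Polynomial.X ^ 2 +
      Polynomial.C b : Polynomial K).natDegree = 4 := by compute_degree!
  have hmonic : (Polynomial.X ^ 4 - Polynomial.C a * Polynomial.X ^ 2 +
      Polynomial.C b : Polynomial K).Monic := by monicity!
  rw [hmonic.irreducible_iff_natDegree']
  refine ⟨fun h => by rw [h] at hdeg; simp at hdeg, ?_⟩
  intro f g hf hg hfg hmem
  rw [hdeg, Finset.mem_Ioc] at hmem
  have hsum : f.natDegree + g.natDegree = 4 := by
    rw [← hdeg, ← hfg, hf.natDegree_mul hg]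
  have hcases : g.natDegree = 1 ∨ g.natDegree = 2 := by omega
  rcases hcases with hg1 | hg2
  · obtain ⟨r, hr⟩ : ∃ r, g.eval r = 0 := by
      refine ⟨-g.coeff 0, ?_⟩
      have hg' : g = Polynomial.X + Polynomial.C (g.coeff 0) := by
        conv_lhs => rw [Polynomial.eq_X_add_C_of_natDegree_le_one hg1.le]
        have : g.coeff 1 = 1 := by rw [← hg1]; exact hg
        rw [this]; simp
      rw [hg']; simp
    have h := congrArg (Polynomial.eval r) hfg
    simp only [Polynomial.eval_mul, hr, mul_zero, Polynomial.eval_add, Polynomial.eval_sub,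
      Polynomial.eval_pow, Polynomial.eval_X, Polynomial.eval_C] at h
    exact h1 ⟨2 * r ^ 2 - a, by linear_combination 4 * h⟩
  · have hf2 : f.natDegree = 2 := by omega
    have form : ∀ q : Polynomial K, q.Monic → q.natDegree = 2 →
        q = Polynomial.X ^ 2 + Polynomial.C (q.coeff 1) * Polynomial.X +
          Polynomial.C (q.coeff 0) := by
      intro q hq hq2
      conv_lhs => rw [Polynomial.eq_quadratic_of_degree_le_two (p := q)
        (Polynomial.degree_le_of_natDegree_le hq2.le)]
      have : q.coeff 2 = 1 := by rw [← hq2]; exact hq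
      rw [this]; simp
    obtain ⟨c, d, hfe⟩ : ∃ c d, f = Polynomial.X ^ 2 + Polynomial.C c * Polynomial.X +
        Polynomial.C d := ⟨_, _, form f hf hf2⟩
    obtain ⟨c', d', hge⟩ : ∃ c d, g = Polynomial.X ^ 2 + Polynomial.C c * Polynomial.X +
        Polynomial.C d := ⟨_, _, form g hg hg2⟩
    have hexp : f * g = Polynomial.X ^ 4 + Polynomial.C (c + c') * Polynomial.X ^ 3 +
        Polynomial.C (d + d' + c * c') * Polynomial.X ^ 2 +
        Polynomial.C (c * d' + c' * d) * Polynomial.X + Polynomial.C (d * d') := by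
      rw [hfe, hge]; simp only [map_add, map_mul]; ring
    rw [hexp] at hfg
    have e0 := congrArg (fun q => Polynomial.coeff q 0) hfg
    have e1 := congrArg (fun q => Polynomial.coeff q 1) hfg
    have e2 := congrArg (fun q => Polynomial.coeff q 2) hfg
    have e3 := congrArg (fun q => Polynomial.coeff q 3) hfg
    simp only [Polynomial.coeff_add, Polynomial.coeff_sub, Polynomial.coeff_C_mul,
      Polynomial.coeff_X_pow, Polynomial.coeff_X, Polynomial.coeff_C] at e0 e1 e2 e3
    norm_num at e0 e1 e2 e3
    have hc' : c' = -c := by linear_combination e3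
    subst hc'
    have : c * (d' - d) = 0 := by linear_combination e1
    rcases mul_eq_zero.1 this with hc | hd
    · refine h1 ⟨d - d', ?_⟩
      subst hc
      have e2' : a = -(d + d') := by linear_combination e2
      rw [e2', ← e0]; ring
    · refine h2 ⟨d, ?_⟩
      rw [← e0]; linear_combination d * hd

theorem natDegree_minpoly_of_biquadratic {K F : Type*} [Field K] [Field F] [Algebra K F] {a b : K}
    {z : F} (hz : z ^ 4 - algebraMap K F a * z ^ 2 + algebraMap K F b = 0)
    (h1 : ¬ IsSquare (a ^ 2 - 4 * b)) (h2 : ¬ IsSquare b) :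
    IsAlgebraic K z ∧ (minpoly K z).natDegree = 4 := by
  have hirr := irreducible_biquadratic h1 h2
  have hmonic : (Polynomial.X ^ 4 - Polynomial.C a * Polynomial.X ^ 2 +
      Polynomial.C b : Polynomial K).Monic := by monicity!
  have hroot : Polynomial.aeval z (Polynomial.X ^ 4 - Polynomial.C a * Polynomial.X ^ 2 +
      Polynomial.C b : Polynomial K) = 0 := by
    simpa using hz
  refine ⟨⟨_, hmonic.ne_zero, hroot⟩, ?_⟩
  rw [← minpoly.eq_of_irreducible_of_monic hirr hroot hmonic]
  compute_degree!

/-- In the application `κ = 1 - tK`. Passing from `z * κ` to `z` divides the discriminant and the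
constant term by `κ⁴`, which is a square. -/
theorem natDegree_minpoly_of_biquadratic_mul {k F : Type*} [Field k] [Field F] [Algebra k F]
    {K : IntermediateField k F} {A B κ z : F} (hA : A ∈ K) (hB : B ∈ K) (hκ : κ ∈ K) (hκ0 : κ ≠ 0)
    (hz : (z * κ) ^ 4 - A * (z * κ) ^ 2 + B = 0) (h1 : ∀ r ∈ K, r ^ 2 ≠ A ^ 2 - 4 * B)
    (h2 : ∀ r ∈ K, r ^ 2 ≠ B) :
    IsAlgebraic K z ∧ (minpoly K z).natDegree = 4 := by
  refine natDegree_minpoly_of_biquadratic (a := ⟨A, hA⟩ / ⟨κ, hκ⟩ ^ 2)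
    (b := ⟨B, hB⟩ / ⟨κ, hκ⟩ ^ 4) ?_ ?_ ?_
  · have e1 : algebraMap K F (⟨A, hA⟩ / ⟨κ, hκ⟩ ^ 2) = A / κ ^ 2 := rfl
    have e2 : algebraMap K F (⟨B, hB⟩ / ⟨κ, hκ⟩ ^ 4) = B / κ ^ 4 := rfl
    rw [e1, e2]
    field_simp
    linear_combination hz
  · rintro ⟨r, hr⟩
    have hr' : (A / κ ^ 2) ^ 2 - 4 * (B / κ ^ 4) = r * r := congrArg (algebraMap K F) hr
    refine h1 (r * κ ^ 2) (mul_mem r.2 (pow_mem hκ 2)) ?_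
    field_simp at hr'
    linear_combination -hr'
  · rintro ⟨r, hr⟩
    have hr' : B / κ ^ 4 = r * r := congrArg (algebraMap K F) hr
    refine h2 (r * κ ^ 2) (mul_mem r.2 (pow_mem hκ 2)) ?_
    field_simp at hr'
    linear_combination -hr'

/-- The multiplicity of `1/c` as a root is even on the left and odd on the right, since `1 - c²X²`
has a simple root there. -/
theorem Polynomial.sq_ne_mul_one_sub_sq_mul_sq {L : Type*} [Field L] [CharZero L] {a c : L}
    (ha : a ≠ 0) (hc : c ≠ 0) {P Q : Polynomial L} (hQ : Q ≠ 0) :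
    P ^ 2 ≠ Polynomial.C a * (1 - Polynomial.C (c ^ 2) * Polynomial.X ^ 2) * Q ^ 2 := by
  intro h
  have hfac : Polynomial.C a * (1 - Polynomial.C (c ^ 2) * Polynomial.X ^ 2) * Q ^ 2 =
      (Polynomial.X - Polynomial.C c⁻¹) *
        ((Polynomial.C (-(a * c)) * (1 + Polynomial.C c * Polynomial.X)) * Q ^ 2) := by
    have : Polynomial.C c * Polynomial.C c⁻¹ = 1 := by
      rw [← map_mul, mul_inv_cancel₀ hc, map_one]
    simp only [map_neg, map_mul, map_pow]
    linear_combination (-(Polynomial.C a * (1 + Polynomial.C c * Polynomial.X) * Q ^ 2)) * this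
  have hne : (Polynomial.C (-(a * c)) * (1 + Polynomial.C c * Polynomial.X)).eval c⁻¹ ≠ 0 := by
    simp only [Polynomial.eval_mul, Polynomial.eval_C, Polynomial.eval_add, Polynomial.eval_one,
      Polynomial.eval_X, mul_inv_cancel₀ hc]
    refine mul_ne_zero (neg_ne_zero.2 (mul_ne_zero ha hc)) ?_
    norm_num
  have h0 : Polynomial.C (-(a * c)) * (1 + Polynomial.C c * Polynomial.X) ≠ 0 := by
    intro h0; rw [h0] at hne; simp at hne
  have hQ2 : Q ^ 2 ≠ 0 := pow_ne_zero 2 hQ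
  have hX : (Polynomial.X - Polynomial.C c⁻¹) ≠ 0 := Polynomial.X_sub_C_ne_zero _
  rw [hfac] at h
  classical
  have hm := congrArg (Polynomial.rootMultiplicity c⁻¹) h
  rw [Polynomial.rootMultiplicity_mul (mul_ne_zero hX (mul_ne_zero h0 hQ2)),
    Polynomial.rootMultiplicity_mul (mul_ne_zero h0 hQ2),
    Polynomial.rootMultiplicity_X_sub_C_self, Polynomial.rootMultiplicity_eq_zero hne,
    ← Polynomial.count_roots, ← Polynomial.count_roots, Polynomial.roots_pow,
    Polynomial.roots_pow, Multiset.count_nsmul, Multiset.count_nsmul] at hm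
  omega

theorem Polynomial.sq_ne_mul_one_sub_sq_mul_sq_of_isDomain {A : Type*} [CommRing A] [IsDomain A]
    [CharZero A] {a c : A} (ha : a ≠ 0) (hc : c ≠ 0) {P Q : Polynomial A} (hQ : Q ≠ 0) :
    P ^ 2 ≠ Polynomial.C a * (1 - Polynomial.C (c ^ 2) * Polynomial.X ^ 2) * Q ^ 2 := by
  intro h
  have inj := IsFractionRing.injective A (FractionRing A)
  have : CharZero (FractionRing A) := charZero_of_injective_algebraMap inj
  have h' := congrArg (Polynomial.map (algebraMap A (FractionRing A))) h
  simp only [Polynomial.map_pow, Polynomial.map_mul, Polynomial.map_sub, Polynomial.map_one,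
    Polynomial.map_C, Polynomial.map_X, map_pow] at h'
  rw [← map_pow] at h'
  refine Polynomial.sq_ne_mul_one_sub_sq_mul_sq (a := algebraMap A (FractionRing A) a)
    (c := algebraMap A (FractionRing A) c) ?_ ?_ ?_ h'
  · exact (map_ne_zero_iff _ inj).2 ha
  · exact (map_ne_zero_iff _ inj).2 hc
  · exact (Polynomial.map_ne_zero_iff inj).2 hQ

theorem Polynomial.sq_ne_map_mul_one_sub_sq {A F : Type*} [CommRing A] [IsDomain A] [CharZero A]
    [Field F] {φ : Polynomial A →+* F} {a c : A} (ha : a ≠ 0) (hc : c ≠ 0)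
    (hφ : Function.Injective φ) {r : F} {P Q : Polynomial A} (hQ : Q ≠ 0) (hr : r * φ Q = φ P)
    {w : Polynomial A} (hw : w ≠ 0) :
    r ^ 2 ≠ φ (w ^ 2 * (Polynomial.C a * (1 - Polynomial.C (c ^ 2) * Polynomial.X ^ 2))) := by
  intro h
  refine Polynomial.sq_ne_mul_one_sub_sq_mul_sq_of_isDomain ha hc (P := P) (mul_ne_zero hw hQ) ?_
  apply hφ
  rw [map_pow, ← hr, mul_pow, h, ← map_pow, ← map_mul]
  congr 1
  ring

/-! ### The degree of the complete generating function -/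

section Degree

variable {k : Type u} [Field k]

/-- The embedding of the polynomials in `t` into `SeriesField k`. -/
def polyToSeriesField (k : Type u) [Field k] : Polynomial (Laurent₂ k) →+* SeriesField k :=
  (algebraMap ((Laurent₂ k)⟦X⟧) (SeriesField k)).comp Polynomial.coeToPowerSeries.ringHom

theorem polyToSeriesField_C (a : Laurent₂ k) :
    polyToSeriesField k (Polynomial.C a) = toSeriesField k (PowerSeries.C a) := by
  simp [polyToSeriesField, toSeriesField]

theorem polyToSeriesField_X :
    polyToSeriesField k Polynomial.X = toSeriesField k PowerSeries.X := by
  simp [polyToSeriesField, toSeriesField]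

theorem polyToSeriesField_injective : Function.Injective (polyToSeriesField k) := by
  rw [polyToSeriesField, RingHom.coe_comp]
  exact (IsFractionRing.injective _ _).comp (Polynomial.coe_injective _)

/-- The three generators are polynomials in `t` over the Laurent ring, so squares in the field can
be tested on polynomials after clearing denominators. -/
theorem exists_polyToSeriesField_mul_eq {r : SeriesField k} (hr : r ∈ rationalFunctions k) :
    ∃ P Q : Polynomial (Laurent₂ k), Q ≠ 0 ∧
      r * polyToSeriesField k Q = polyToSeriesField k P := by
  have hsub : ∀ z ∈ Algebra.adjoin k
      {toSeriesField k (PowerSeries.C (mon k 1 0)), toSeriesField k (PowerSeries.C (mon k 0 1)),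
        toSeriesField k PowerSeries.X}, z ∈ (polyToSeriesField k).range := by
    intro z hz
    induction hz using Algebra.adjoin_induction with
    | mem z hz =>
      simp only [Set.mem_insert_iff, Set.mem_singleton_iff] at hz
      rcases hz with rfl | rfl | rfl
      · exact ⟨_, polyToSeriesField_C _⟩
      · exact ⟨_, polyToSeriesField_C _⟩
      · exact ⟨_, polyToSeriesField_X⟩
    | algebraMap c =>
      refine ⟨Polynomial.C (algebraMap k (Laurent₂ k) c), ?_⟩
      rw [polyToSeriesField_C, toSeriesField,
        IsScalarTower.algebraMap_apply k ((Laurent₂ k)⟦X⟧) (SeriesField k),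
        PowerSeries.algebraMap_apply]
    | add x y _ _ hx hy => exact Subring.add_mem _ hx hy
    | mul x y _ _ hx hy => exact Subring.mul_mem _ hx hy
  obtain ⟨p, hp, q, hq, rfl⟩ := IntermediateField.mem_adjoin_iff_div.1 hr
  obtain ⟨P, rfl⟩ := hsub p hp
  obtain ⟨Q, rfl⟩ := hsub q hq
  by_cases hQ : Q = 0
  -- A quotient with zero denominator is 0 by convention, and is written as `0/1`.
  · exact ⟨0, 1, one_ne_zero, by simp [hQ]⟩
  · refine ⟨P, Q, hQ, div_mul_cancel₀ _ ?_⟩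
    exact (map_ne_zero_iff _ polyToSeriesField_injective).2 hQ

theorem not_isSquare_rationalFunctions [CharZero k] {a c : Laurent₂ k} (ha : a ≠ 0) (hc : c ≠ 0)
    {r : SeriesField k} (hr : r ∈ rationalFunctions k) {w : Polynomial (Laurent₂ k)} (hw : w ≠ 0) :
    r ^ 2 ≠ polyToSeriesField k
      (w ^ 2 * (Polynomial.C a * (1 - Polynomial.C (c ^ 2) * Polynomial.X ^ 2))) := by
  obtain ⟨P, Q, hQ, hPQ⟩ := exists_polyToSeriesField_mul_eq hr
  exact Polynomial.sq_ne_map_mul_one_sub_sq ha hc polyToSeriesField_injective hQ hPQ hw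

theorem mon_ne_zero (i j : ℤ) : mon k i j ≠ 0 := by
  rw [mon]
  simp

theorem toSeriesField_X_mem : toSeriesField k PowerSeries.X ∈ rationalFunctions k :=
  IntermediateField.subset_adjoin _ _ (by simp)

theorem toSeriesField_mon_mem {i j : ℤ} (h : toSeriesField k (PowerSeries.C (mon k i j)) ∈
    rationalFunctions k) : toSeriesField k (PowerSeries.C (mon k (-i) (-j))) ∈
    rationalFunctions k := by
  have : toSeriesField k (PowerSeries.C (mon k (-i) (-j))) =
      (toSeriesField k (PowerSeries.C (mon k i j)))⁻¹ := by
    refine eq_inv_of_mul_eq_one_left ?_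
    rw [toSeriesField, toSeriesField, ← map_mul, ← map_mul, mon_mul_mon]
    simp [mon_zero_zero]
  rw [this]
  exact IntermediateField.inv_mem _ h

theorem toSeriesField_x_mem : toSeriesField k (PowerSeries.C (mon k 1 0)) ∈ rationalFunctions k :=
  IntermediateField.subset_adjoin _ _ (by simp)

theorem toSeriesField_y_mem : toSeriesField k (PowerSeries.C (mon k 0 1)) ∈ rationalFunctions k :=
  IntermediateField.subset_adjoin _ _ (by simp)

theorem mon_add_mon_ne_zero : mon k 1 0 + mon k (-1) 0 ≠ 0 := by
  intro h
  have := congrArg (fun f => f.coeff (1, 0)) h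
  simp [mon] at this

theorem laurent₂_four_ne_zero [CharZero k] : (4 : Laurent₂ k) ≠ 0 := by
  have h : ((4 : ℕ) : Laurent₂ k) ≠ 0 := Nat.cast_ne_zero.2 (by norm_num)
  exact_mod_cast h

theorem isAlgebraicOfDegree_slitSeries [CharZero k] : IsAlgebraicOfDegree k (slitSeries k) 4 := by
  obtain ⟨ρ, hρ, hρ1⟩ := PowerSeries.exists_pow_eq_of_constantCoeff_eq_one two_ne_zero
    (f := (1 - 16 * PowerSeries.X ^ 2 : k⟦X⟧)) (by simp)
  have hmain := two_mul_slitSeries_mul_sq hρ hρ1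
  have hρ' := congrArg (PowerSeries.map (algebraMap k (Laurent₂ k))) hρ
  rw [map_pow, map_sub, map_one, PowerSeries.map_ofNat_mul_X_pow] at hρ'
  have hxx : PowerSeries.C (mon k 1 0) * PowerSeries.C (mon k (-1) 0) = 1 := by
    rw [← map_mul, mon_mul_mon]; norm_num [mon_zero_zero]
  -- Eliminate `ρ = 2Z² - A` through `ρ² = 1 - 16t²`; the constant term is `B = (A² - 1 + 16t²)/4`.
  have hquart : (slitSeries k * (1 - PowerSeries.X * PowerSeries.C (stepPoly k))) ^ 4 -
      (1 - 8 * PowerSeries.X ^ 2 * (1 + PowerSeries.C (mon k (-1) 0) ^ 2)) *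
        (slitSeries k * (1 - PowerSeries.X * PowerSeries.C (stepPoly k))) ^ 2 +
      4 * PowerSeries.X ^ 2 * PowerSeries.C (mon k (-1) 0) ^ 2 *
        (4 * PowerSeries.X ^ 2 * (PowerSeries.C (mon k 1 0) + PowerSeries.C (mon k (-1) 0)) ^ 2
          - 1) = 0 := by
    have h4 : (4 : (Laurent₂ k)⟦X⟧) ≠ 0 := by
      rw [← map_ofNat PowerSeries.C 4]
      exact (map_ne_zero_iff _ PowerSeries.C_injective).2 laurent₂_four_ne_zero
    refine mul_left_cancel₀ h4 ?_
    rw [map_pow] at hmain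
    linear_combination (2 * (slitSeries k * (1 - PowerSeries.X * PowerSeries.C (stepPoly k))) ^ 2 -
      (1 - 8 * PowerSeries.X ^ 2 * (1 + PowerSeries.C (mon k (-1) 0) ^ 2)) +
      PowerSeries.map (algebraMap k (Laurent₂ k)) ρ) * hmain + hρ' +
      64 * PowerSeries.X ^ 4 * (PowerSeries.C (mon k 1 0) * PowerSeries.C (mon k (-1) 0) + 1 +
        2 * PowerSeries.C (mon k (-1) 0) ^ 2) * hxx
  have hF := congrArg (algebraMap ((Laurent₂ k)⟦X⟧) (SeriesField k)) hquart
  simp only [map_add, map_sub, map_mul, map_pow, map_one, map_ofNat, map_zero] at hF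
  have ht := toSeriesField_X_mem (k := k)
  have hx := toSeriesField_x_mem (k := k)
  have hx' : toSeriesField k (PowerSeries.C (mon k (-1) 0)) ∈ rationalFunctions k := by
    simpa using toSeriesField_mon_mem hx
  have hy := toSeriesField_y_mem (k := k)
  have hy' : toSeriesField k (PowerSeries.C (mon k 0 (-1))) ∈ rationalFunctions k := by
    simpa using toSeriesField_mon_mem hy
  have hxxF := congrArg (algebraMap ((Laurent₂ k)⟦X⟧) (SeriesField k)) hxx
  rw [map_mul, map_one] at hxxF
  have hstep : algebraMap ((Laurent₂ k)⟦X⟧) (SeriesField k) (PowerSeries.C (stepPoly k)) ∈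
      rationalFunctions k := by
    rw [stepPoly]
    simp only [map_add, map_mul]
    exact mul_mem (add_mem hx hx') (add_mem hy hy')
  unfold IsAlgebraicOfDegree
  refine natDegree_minpoly_of_biquadratic_mul ?_ ?_ ?_ ?_ hF ?_ ?_
  · exact sub_mem (one_mem _) (mul_mem (mul_mem (ofNat_mem _ 8) (pow_mem ht 2))
      (add_mem (one_mem _) (pow_mem hx' 2)))
  · exact mul_mem (mul_mem (mul_mem (ofNat_mem _ 4) (pow_mem ht 2)) (pow_mem hx' 2))
      (sub_mem (mul_mem (mul_mem (ofNat_mem _ 4) (pow_mem ht 2)) (pow_mem (add_mem hx hx') 2))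
        (one_mem _))
  · exact sub_mem (one_mem _) (mul_mem ht hstep)
  · rw [← map_one (algebraMap ((Laurent₂ k)⟦X⟧) (SeriesField k)), ← map_mul, ← map_sub]
    refine (map_ne_zero_iff _ (IsFractionRing.injective _ _)).2 fun h => ?_
    have := congrArg PowerSeries.constantCoeff h
    simp at this
  -- The discriminant `A² - 4B` is `1 - 16t²`.
  · intro r hr h
    refine not_isSquare_rationalFunctions (a := 1) (c := 4) one_ne_zero laurent₂_four_ne_zero hr
      (w := 1) one_ne_zero ?_
    rw [h]
    simp only [map_mul, map_sub, map_one, map_pow, polyToSeriesField_X, map_ofNat, toSeriesField]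
    linear_combination (-64 * algebraMap ((Laurent₂ k)⟦X⟧) (SeriesField k) PowerSeries.X ^ 4 *
      (algebraMap ((Laurent₂ k)⟦X⟧) (SeriesField k) (PowerSeries.C (mon k 1 0)) *
        algebraMap ((Laurent₂ k)⟦X⟧) (SeriesField k) (PowerSeries.C (mon k (-1) 0)) + 1 +
        2 * algebraMap ((Laurent₂ k)⟦X⟧) (SeriesField k)
          (PowerSeries.C (mon k (-1) 0)) ^ 2)) * hxxF
  -- The constant term is `B = -(2t/x)² (1 - 4t²(x + 1/x)²)`.
  · intro r hr h
    refine not_isSquare_rationalFunctions (a := -1) (c := 2 * (mon k 1 0 + mon k (-1) 0))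
      (neg_ne_zero.2 one_ne_zero) (mul_ne_zero two_ne_zero mon_add_mon_ne_zero) hr
      (w := 2 * (Polynomial.C (mon k (-1) 0) * Polynomial.X))
      (mul_ne_zero two_ne_zero (mul_ne_zero (Polynomial.C_ne_zero.2 (mon_ne_zero _ _))
        Polynomial.X_ne_zero)) ?_
    rw [h]
    simp only [map_mul, map_sub, map_add, map_one, map_pow, map_neg, polyToSeriesField_X,
      polyToSeriesField_C, map_ofNat, toSeriesField]
    ring

end Degree

/-! ### The specialization `x = y = 1` -/

theorem evalOne_apply {R : Type u} [CommRing R] (f : Laurent₂ R) :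
    evalOne R f = f.coeff.sum fun _ a => a := by
  change AddMonoidAlgebra.lift R R (ℤ × ℤ) (1 : Multiplicative (ℤ × ℤ) →* R) f = _
  rw [AddMonoidAlgebra.lift_apply]
  simp

theorem evalOne_slitCoeff (n : ℕ) : evalOne ℝ (slitCoeff ℝ n) = numWalks n := by
  rw [evalOne_apply, numWalks_eq_sum, Nat.cast_sum]
  refine Finset.sum_subset (fun p hp => ?_) fun p _ hp => ?_
  · rw [Finsupp.mem_support_iff, coeff_slitCoeff] at hp
    exact mem_box_of_numWalksTo_ne_zero fun h => hp (by rw [h, Nat.cast_zero])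
  · rw [Finsupp.mem_support_iff, not_not] at hp
    exact hp

theorem map_evalOne_slitSeries :
    PowerSeries.map (evalOne ℝ) (slitSeries ℝ) = PowerSeries.mk (fun n => (numWalks n : ℝ)) := by
  ext n
  rw [PowerSeries.coeff_map, slitSeries, PowerSeries.coeff_mk, PowerSeries.coeff_mk,
    evalOne_slitCoeff]

theorem evalOne_mon (i j : ℤ) : evalOne ℝ (mon ℝ i j) = 1 := by
  rw [evalOne_apply, mon, AddMonoidAlgebra.coeff_single, Finsupp.sum_single_index rfl]

theorem evalOne_comp_algebraMap : (evalOne ℝ).comp (algebraMap ℝ (Laurent₂ ℝ)) = RingHom.id ℝ := by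
  ext a
  change AddMonoidAlgebra.lift ℝ ℝ (ℤ × ℤ) (1 : Multiplicative (ℤ × ℤ) →* ℝ) _ = a
  rw [AlgHom.commutes]
  rfl

/-- The generating function of all walks by their length. -/
def walkSeries : ℝ⟦X⟧ := PowerSeries.mk fun n => (numWalks n : ℝ)

/-- At `x = 1` the radicand becomes `1 - 16t² + ρ = ρ² + ρ`. -/
theorem two_mul_walkSeries_mul_sq {ρ : ℝ⟦X⟧} (hρ : ρ ^ 2 = 1 - 16 * PowerSeries.X ^ 2)
    (hρ1 : PowerSeries.constantCoeff ρ = 1) :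
    2 * (walkSeries * (1 - 4 * PowerSeries.X)) ^ 2 = ρ * (1 + ρ) := by
  have h := congrArg (PowerSeries.map (evalOne ℝ)) (two_mul_slitSeries_mul_sq hρ hρ1)
  have h2 : PowerSeries.map (evalOne ℝ) (PowerSeries.map (algebraMap ℝ (Laurent₂ ℝ)) ρ) = ρ := by
    rw [← RingHom.comp_apply, ← PowerSeries.map_comp, evalOne_comp_algebraMap]
    simp
  simp only [stepPoly, map_mul, map_add, map_sub, map_pow, map_one, map_ofNat, PowerSeries.map_X,
    PowerSeries.map_C, evalOne_mon, h2, map_evalOne_slitSeries] at h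
  rw [walkSeries]
  linear_combination h - hρ

theorem constantCoeff_walkSeries : PowerSeries.constantCoeff walkSeries = 1 := by
  rw [walkSeries, ← PowerSeries.coeff_zero_eq_constantCoeff_apply, PowerSeries.coeff_mk,
    ← evalOne_slitCoeff, slitCoeff_zero, map_one]

theorem exists_two_mul_sq_eq {ρ : ℝ⟦X⟧} (hρ1 : PowerSeries.constantCoeff ρ = 1) :
    ∃ s : ℝ⟦X⟧, 2 * s ^ 2 = 1 + ρ ∧ PowerSeries.constantCoeff s = 1 := by
  obtain ⟨s, hs, hs1⟩ := PowerSeries.exists_pow_eq_of_constantCoeff_eq_one two_ne_zero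
    (f := PowerSeries.C (1 / 2) * (1 + ρ)) (by
      rw [map_mul, map_add, hρ1, map_one, PowerSeries.constantCoeff_C]; norm_num)
  refine ⟨s, ?_, hs1⟩
  have : (2 : ℝ⟦X⟧) * PowerSeries.C (1 / 2) = 1 := by
    rw [← map_ofNat PowerSeries.C 2, ← map_mul]; norm_num
  rw [hs, ← mul_assoc, this, one_mul]

theorem walkSeries_closed_form :
    ∃ ρ σ α β : ℝ⟦X⟧,
      IsPosRoot 2 (1 - 16 * PowerSeries.X ^ 2) ρ ∧ IsPosRoot 2 (1 + ρ) σ ∧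
      IsPosRoot 4 (1 + 4 * PowerSeries.X) α ∧ IsPosRoot 4 (1 - 4 * PowerSeries.X) β ∧
      PowerSeries.mk (fun n => (numWalks n : ℝ)) * (PowerSeries.C (Real.sqrt 2) * β ^ 3) =
        α * σ := by
  obtain ⟨ρ, hρ, hρ1⟩ := PowerSeries.exists_pow_eq_of_constantCoeff_eq_one two_ne_zero
    (f := (1 - 16 * PowerSeries.X ^ 2 : ℝ⟦X⟧)) (by simp)
  obtain ⟨α, hα, hα1⟩ := PowerSeries.exists_pow_eq_of_constantCoeff_eq_one four_ne_zero
    (f := (1 + 4 * PowerSeries.X : ℝ⟦X⟧)) (by simp)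
  obtain ⟨β, hβ, hβ1⟩ := PowerSeries.exists_pow_eq_of_constantCoeff_eq_one four_ne_zero
    (f := (1 - 4 * PowerSeries.X : ℝ⟦X⟧)) (by simp)
  obtain ⟨s, hs, hs1⟩ := exists_two_mul_sq_eq hρ1
  have hαβ : α ^ 2 * β ^ 2 = ρ := by
    refine PowerSeries.eq_of_sq_eq_sq ?_ (by simp [hα1, hβ1]) hρ1
    rw [hρ]
    linear_combination β ^ 4 * hα + (1 + 4 * PowerSeries.X) * hβ
  have hβ0 : 2 * β ^ 2 ≠ 0 := by
    intro h
    have := congrArg PowerSeries.constantCoeff h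
    rw [map_mul, map_pow, hβ1, map_ofNat, map_zero] at this
    norm_num at this
  -- After squaring and multiplying by `2β²`, both sides equal `ρ(1 + ρ)`, because `β⁴ = 1 - 4t` and
  -- `α²β² = ρ`.
  have key : walkSeries * β ^ 3 = α * s := by
    refine PowerSeries.eq_of_sq_eq_sq ?_ (by simp [hβ1, constantCoeff_walkSeries])
      (by simp [hα1, hs1])
    refine mul_left_cancel₀ hβ0 ?_
    have h := two_mul_walkSeries_mul_sq hρ hρ1
    linear_combination h + 2 * walkSeries ^ 2 * (β ^ 4 + 1 - 4 * PowerSeries.X) * hβ -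
      (1 + ρ) * hαβ - α ^ 2 * β ^ 2 * hs
  refine ⟨ρ, PowerSeries.C (Real.sqrt 2) * s, α, β, ⟨hρ, 1, one_pos, hρ1⟩,
    ⟨?_, Real.sqrt 2, by positivity, by simp [hs1]⟩, ⟨hα, 1, one_pos, hα1⟩,
    ⟨hβ, 1, one_pos, hβ1⟩, ?_⟩
  · rw [mul_pow, ← map_pow, Real.sq_sqrt (by norm_num), map_ofNat, hs]
  · rw [← walkSeries]
    linear_combination PowerSeries.C (Real.sqrt 2) * key

/-! ### Reduction of the numbers of walks to a product of two series -/

/-- Since `(1 + 4t)^(1/4) (1 - 4t)^(-3/4) = (1 + 4t)(1 - 16t²)^(-3/4)`, the series is `1 + 4t` times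
a series in `w = 16t²`. The coefficients of index `2m` and `2m + 1` therefore come from the same
coefficient of `w^m`, which explains `n / 2`. -/
theorem exists_walkSeries_factors :
    ∃ P G : ℝ⟦X⟧, P ^ 4 * (1 - PowerSeries.X) ^ 3 = 1 ∧ PowerSeries.constantCoeff P = 1 ∧
      (2 * G ^ 2 - 1) ^ 2 = 1 - PowerSeries.X ∧ PowerSeries.constantCoeff G = 1 ∧
      ∀ n, (numWalks n : ℝ) = 4 ^ n * PowerSeries.coeff (n / 2) (P * G) := by
  obtain ⟨Q, hQ, hQ1⟩ := PowerSeries.exists_pow_eq_of_constantCoeff_eq_one two_ne_zero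
    (f := (1 - PowerSeries.X : ℝ⟦X⟧)) (by simp)
  obtain ⟨G, hG, hG1⟩ := exists_two_mul_sq_eq hQ1
  obtain ⟨g, hg, hg1⟩ := PowerSeries.exists_mul_eq_one
    (f := ((1 - PowerSeries.X) ^ 3 : ℝ⟦X⟧)) (by simp)
  obtain ⟨P, hP, hP1⟩ := PowerSeries.exists_pow_eq_of_constantCoeff_eq_one four_ne_zero hg1
  have hP' : P ^ 4 * (1 - PowerSeries.X) ^ 3 = 1 := by rw [hP, mul_comm, hg]
  have hPQ : P ^ 2 * Q ^ 3 = 1 := by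
    refine PowerSeries.eq_of_sq_eq_sq ?_ (by simp [hP1, hQ1]) (by simp)
    rw [one_pow, ← hP', ← hQ]; ring
  refine ⟨P, G, hP', hP1, ?_, hG1, ?_⟩
  · rw [← hQ]; linear_combination (2 * G ^ 2 - 1 + Q) * hG
  -- `E` is the substitution `w = 16t²`.
  let E : ℝ⟦X⟧ →+* ℝ⟦X⟧ := (PowerSeries.rescale (4 : ℝ)).comp
    (PowerSeries.expand 2 two_ne_zero : ℝ⟦X⟧ →ₐ[ℝ] ℝ⟦X⟧).toRingHom
  have hEX : E PowerSeries.X = 16 * PowerSeries.X ^ 2 := by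
    change PowerSeries.rescale (4 : ℝ) (PowerSeries.expand 2 two_ne_zero PowerSeries.X) = _
    rw [PowerSeries.expand_X, map_pow, PowerSeries.rescale_X, mul_pow, map_ofNat]
    norm_num
  have hEc : ∀ f n, PowerSeries.coeff n (E f) =
      4 ^ n * if 2 ∣ n then PowerSeries.coeff (n / 2) f else 0 := by
    intro f n
    change PowerSeries.coeff n (PowerSeries.rescale (4 : ℝ)
      (PowerSeries.expand 2 two_ne_zero f)) = _
    rw [PowerSeries.coeff_rescale, PowerSeries.coeff_expand]
  have hE1 : ∀ f, PowerSeries.constantCoeff (E f) = PowerSeries.constantCoeff f := by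
    intro f
    rw [← PowerSeries.coeff_zero_eq_constantCoeff_apply, hEc]
    simp
  have hA : walkSeries = (1 + 4 * PowerSeries.X) * E (P * G) := by
    have hρ : (E Q) ^ 2 = 1 - 16 * PowerSeries.X ^ 2 := by
      rw [← map_pow, hQ, map_sub, map_one, hEX]
    have h := two_mul_walkSeries_mul_sq hρ (by rw [hE1, hQ1])
    have hPQ' := congrArg E hPQ
    have hG' := congrArg E hG
    simp only [map_mul, map_pow, map_one, map_add, map_ofNat] at hPQ' hG'
    refine PowerSeries.eq_of_sq_eq_sq ?_ constantCoeff_walkSeries (by simp [hE1, hP1, hG1])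
    have h0 : (2 * (1 - 4 * PowerSeries.X) ^ 2 : ℝ⟦X⟧) ≠ 0 := by
      intro h
      have := congrArg PowerSeries.constantCoeff h
      simp only [map_mul, map_pow, map_sub, map_one, map_ofNat, PowerSeries.constantCoeff_X,
        map_zero] at this
      norm_num at this
    refine mul_left_cancel₀ h0 ?_
    rw [map_mul]
    linear_combination h - (E Q * (1 + E Q)) * hPQ' - E P ^ 2 * E Q ^ 4 * hG' +
      2 * E P ^ 2 * E G ^ 2 * (E Q ^ 2 + 1 - 16 * PowerSeries.X ^ 2) * hρ
  intro n
  have hn : (numWalks n : ℝ) = PowerSeries.coeff n walkSeries := by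
    rw [walkSeries, PowerSeries.coeff_mk]
  have e : (1 + 4 * PowerSeries.X) * E (P * G) =
      E (P * G) + PowerSeries.C 4 * (PowerSeries.X * E (P * G)) := by
    rw [map_ofNat]; ring
  rw [hn, hA, e, map_add, PowerSeries.coeff_C_mul]
  cases n with
  | zero => simp [hE1]
  | succ n =>
    rw [PowerSeries.coeff_succ_X_mul, hEc, hEc]
    by_cases h2 : 2 ∣ n
    · rw [if_pos h2, if_neg (by omega), show (n + 1) / 2 = n / 2 by omega]
      ring
    · rw [if_neg h2, if_pos (by omega)]
      ring

/-! ### Asymptotics of the coefficients of `(1 - w) ^ (-3/4)` -/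

/-- Differentiating the hypothesis and cancelling gives `4(1 - X) P' = 3P`. -/
theorem succ_mul_coeff_of_pow_four_mul {P : ℝ⟦X⟧} (hP : P ^ 4 * (1 - PowerSeries.X) ^ 3 = 1)
    (n : ℕ) : ((n : ℝ) + 1) * PowerSeries.coeff (n + 1) P =
      (n + 3 / 4) * PowerSeries.coeff n P := by
  have hd := congrArg (PowerSeries.derivative ℝ) hP
  simp only [Derivation.leibniz, Derivation.leibniz_pow, map_sub, PowerSeries.derivative_X,
    smul_eq_mul, PowerSeries.derivative_one] at hd
  have hne : P ^ 3 * (1 - PowerSeries.X) ^ 2 ≠ 0 := by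
    intro h
    have : (1 : ℝ⟦X⟧) = 0 := by
      rw [← hP]; linear_combination P * (1 - PowerSeries.X) * h
    exact one_ne_zero this
  have hode : 4 * ((1 - PowerSeries.X) * PowerSeries.derivative ℝ P) = 3 * P := by
    refine mul_left_cancel₀ hne ?_
    simp only [nsmul_eq_mul, Nat.cast_ofNat] at hd
    linear_combination hd
  have e : (4 : ℝ⟦X⟧) * ((1 - PowerSeries.X) * PowerSeries.derivative ℝ P) =
      PowerSeries.C 4 * PowerSeries.derivative ℝ P -
        PowerSeries.C 4 * (PowerSeries.X * PowerSeries.derivative ℝ P) := by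
    rw [map_ofNat]; ring
  have e3 : 3 * P = PowerSeries.C 3 * P := by rw [map_ofNat]
  rw [e, e3] at hode
  have h := congrArg (PowerSeries.coeff n) hode
  rw [map_sub, PowerSeries.coeff_C_mul, PowerSeries.coeff_C_mul, PowerSeries.coeff_C_mul,
    PowerSeries.coeff_derivative] at h
  cases n with
  | zero =>
    rw [PowerSeries.coeff_zero_X_mul] at h
    push_cast at h ⊢
    linear_combination h / 4
  | succ n =>
    rw [PowerSeries.coeff_succ_X_mul, PowerSeries.coeff_derivative] at h
    push_cast at h ⊢
    linear_combination h / 4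

theorem coeff_eq_prod_div_factorial {c : ℕ → ℝ} (h0 : c 0 = 1)
    (hc : ∀ n : ℕ, ((n : ℝ) + 1) * c (n + 1) = (n + 3 / 4) * c n) (n : ℕ) :
    c n = (∏ j ∈ Finset.range n, ((3 / 4 : ℝ) + j)) / n.factorial := by
  induction n with
  | zero => simp [h0]
  | succ n ih =>
    have h := hc n
    rw [ih] at h
    rw [Finset.prod_range_succ, Nat.factorial_succ, Nat.cast_mul]
    have hn : (n : ℝ) + 1 ≠ 0 := by positivity
    have hf : (n.factorial : ℝ) ≠ 0 := by positivity
    push_cast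
    field_simp at h ⊢
    linear_combination h

theorem coeff_pos_of_recurrence {c : ℕ → ℝ} (h0 : c 0 = 1)
    (hc : ∀ n : ℕ, ((n : ℝ) + 1) * c (n + 1) = (n + 3 / 4) * c n) (n : ℕ) : 0 < c n := by
  rw [coeff_eq_prod_div_factorial h0 hc]
  have : 0 < ∏ j ∈ Finset.range n, ((3 / 4 : ℝ) + j) :=
    Finset.prod_pos fun j _ => by positivity
  positivity

/-- By Euler's limit formula: for `n > 0` the term is `n / (n + 3/4)` divided by `Real.GammaSeq (3 /
4) n`. -/
theorem tendsto_coeff_mul_rpow {c : ℕ → ℝ} (h0 : c 0 = 1)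
    (hc : ∀ n : ℕ, ((n : ℝ) + 1) * c (n + 1) = (n + 3 / 4) * c n) :
    Tendsto (fun n : ℕ => c n * (n : ℝ) ^ (1 / 4 : ℝ)) atTop
      (nhds (1 / Real.Gamma (3 / 4))) := by
  have hG := Real.GammaSeq_tendsto_Gamma (3 / 4)
  have hpos : Real.Gamma (3 / 4) ≠ 0 := (Real.Gamma_pos_of_pos (by norm_num)).ne'
  have h1 : Tendsto (fun n : ℕ => (n : ℝ) / (n + 3 / 4)) atTop (nhds 1) :=
    tendsto_natCast_div_add_atTop (3 / 4 : ℝ)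
  refine (h1.div hG hpos).congr' ?_
  filter_upwards [eventually_gt_atTop 0] with n hn
  have hn' : (0 : ℝ) < n := by exact_mod_cast hn
  simp only [Pi.div_apply]
  rw [Real.GammaSeq, coeff_eq_prod_div_factorial h0 hc, Finset.prod_range_succ]
  have hp : 0 < ∏ j ∈ Finset.range n, ((3 / 4 : ℝ) + j) :=
    Finset.prod_pos fun j _ => by positivity
  have hr : (n : ℝ) ^ (1 / 4 : ℝ) * (n : ℝ) ^ (3 / 4 : ℝ) = n := by
    rw [← Real.rpow_add hn']; norm_num
  have hf : (n.factorial : ℝ) ≠ 0 := by positivity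
  rw [div_div_eq_mul_div, div_mul_eq_mul_div, div_div, div_mul_eq_mul_div,
    div_eq_div_iff (by positivity) hf]
  linear_combination (-(∏ j ∈ Finset.range n, ((3 / 4 : ℝ) + j)) * (3 / 4 + n) *
    (n.factorial : ℝ)) * hr

/-- This is the bound for dominated convergence. The sequence `c m ^ 4 * (m + 1)` decreases from 1,
and `c m ^ 4 * m` increases from `(3/4)^4` for `m ≥ 1`. With `n = k + j ≤ (k + 1)(j + 1)`, the ratio
of the two estimates gives the claim. -/
theorem coeff_sub_div_le {c : ℕ → ℝ} (h0 : c 0 = 1)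
    (hc : ∀ n : ℕ, ((n : ℝ) + 1) * c (n + 1) = (n + 3 / 4) * c n) {k n : ℕ}
    (hk : k ≤ n) :
    c (n - k) / c n ≤ 4 / 3 * ((k : ℝ) + 1) ^ (1 / 4 : ℝ) := by
  have hpos := coeff_pos_of_recurrence h0 hc
  have hupper : ∀ m : ℕ, c m ^ 4 * (m + 1) ≤ 1 := by
    intro m
    induction m with
    | zero => simp [h0]
    | succ m ih =>
      have hm : (0 : ℝ) ≤ m := m.cast_nonneg
      have h : c (m + 1) = (m + 3 / 4) / (m + 1) * c m := by
        rw [div_mul_eq_mul_div, eq_div_iff (by positivity)]; linear_combination hc m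
      have hle : ((m + 3 / 4 : ℝ) / (m + 1)) ^ 4 * (m + 2) ≤ m + 1 := by
        rw [div_pow, div_mul_eq_mul_div, div_le_iff₀ (by positivity)]
        nlinarith [pow_nonneg hm 2, pow_nonneg hm 3, pow_nonneg hm 4, pow_nonneg hm 5]
      calc c (m + 1) ^ 4 * ((m + 1 : ℕ) + 1)
          = c m ^ 4 * (((m + 3 / 4 : ℝ) / (m + 1)) ^ 4 * (m + 2)) := by
            rw [h]; push_cast; ring
        _ ≤ c m ^ 4 * (m + 1) := by gcongr
        _ ≤ 1 := ih
  have hlower : ∀ m : ℕ, (3 / 4 : ℝ) ^ 4 ≤ c (m + 1) ^ 4 * (m + 1) := by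
    intro m
    induction m with
    | zero =>
      have h1 : c 1 = 3 / 4 := by have := hc 0; rw [h0] at this; norm_num at this; exact this
      simp [h1]
    | succ m ih =>
      have hm : (0 : ℝ) ≤ m := m.cast_nonneg
      have h : c (m + 1 + 1) = (m + 7 / 4) / (m + 2) * c (m + 1) := by
        have := hc (m + 1)
        push_cast at this
        rw [div_mul_eq_mul_div, eq_div_iff (by positivity)]; linear_combination this
      have hle : (m + 1 : ℝ) ≤ ((m + 7 / 4 : ℝ) / (m + 2)) ^ 4 * (m + 2) := by
        rw [div_pow, div_mul_eq_mul_div, le_div_iff₀ (by positivity)]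
        nlinarith [pow_nonneg hm 2, pow_nonneg hm 3, pow_nonneg hm 4, pow_nonneg hm 5]
      calc (3 / 4 : ℝ) ^ 4 ≤ c (m + 1) ^ 4 * (m + 1) := ih
        _ ≤ c (m + 1) ^ 4 * (((m + 7 / 4 : ℝ) / (m + 2)) ^ 4 * (m + 2)) := by gcongr
        _ = c (m + 1 + 1) ^ 4 * ((m + 1 : ℕ) + 1) := by rw [h]; push_cast; ring
  have hr : 0 ≤ c (n - k) / c n := (div_pos (hpos _) (hpos _)).le
  have hk1 : (0 : ℝ) ≤ (k : ℝ) + 1 := by positivity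
  have hpow : (4 / 3 * ((k : ℝ) + 1) ^ (1 / 4 : ℝ)) ^ 4 = (4 / 3) ^ 4 * (k + 1) := by
    rw [mul_pow, ← Real.rpow_natCast (((k : ℝ) + 1) ^ (1 / 4 : ℝ)), ← Real.rpow_mul hk1]
    norm_num
  refine (pow_le_pow_iff_left₀ hr (by positivity) four_ne_zero).1 ?_
  rw [hpow]
  obtain ⟨j, rfl⟩ := Nat.exists_eq_add_of_le hk
  rw [Nat.add_sub_cancel_left, div_pow, div_le_iff₀ (pow_pos (hpos _) 4)]
  cases k with
  | zero =>
    simp only [zero_add, Nat.cast_zero, mul_one]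
    have := pow_pos (hpos j) 4
    norm_num
    linarith
  | succ k =>
    have h1 := hupper j
    have h2 := hlower (k + j)
    rw [show k + 1 + j = k + j + 1 by omega]
    push_cast at h2 ⊢
    have hj : (0 : ℝ) < (j : ℝ) + 1 := by positivity
    have hkj : (k : ℝ) + j + 1 ≤ (k + 1 + 1) * (j + 1) := by
      nlinarith [k.cast_nonneg (α := ℝ), j.cast_nonneg (α := ℝ)]
    have hp4 := pow_pos (hpos (k + j + 1)) 4
    refine le_of_mul_le_mul_right ?_ hj
    calc c j ^ 4 * (j + 1) ≤ 1 := h1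
      _ = (4 / 3) ^ 4 * (3 / 4) ^ 4 := by norm_num
      _ ≤ (4 / 3) ^ 4 * (c (k + j + 1) ^ 4 * (k + j + 1)) := by gcongr
      _ ≤ (4 / 3) ^ 4 * (c (k + j + 1) ^ 4 * ((k + 1 + 1) * (j + 1))) := by gcongr
      _ = _ := by ring

theorem tendsto_coeff_sub_div {c : ℕ → ℝ} (h0 : c 0 = 1)
    (hc : ∀ n : ℕ, ((n : ℝ) + 1) * c (n + 1) = (n + 3 / 4) * c n) (k : ℕ) :
    Tendsto (fun n => c (n - k) / c n) atTop (nhds 1) := by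
  have hpos := coeff_pos_of_recurrence h0 hc
  have h1 : Tendsto (fun n => c n / c (n + 1)) atTop (nhds 1) := by
    have h : Tendsto (fun n : ℕ => ((n : ℝ) / (n + 3 / 4) + 1 / (n : ℝ) * ((n : ℝ) / (n + 3 / 4))))
        atTop (nhds (1 + 0 * 1)) :=
      (tendsto_natCast_div_add_atTop (3 / 4 : ℝ)).add
        (tendsto_one_div_atTop_nhds_zero_nat.mul (tendsto_natCast_div_add_atTop (3 / 4 : ℝ)))
    rw [zero_mul, add_zero] at h
    refine h.congr' ?_
    filter_upwards [eventually_gt_atTop 0] with n hn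
    have hn' : (0 : ℝ) < n := by exact_mod_cast hn
    have hcn := hpos (n + 1)
    rw [eq_div_iff hcn.ne']
    field_simp
    linear_combination 4 * hc n
  have h2 : Tendsto (fun n => c n / c (n + k)) atTop (nhds 1) := by
    induction k with
    | zero => exact tendsto_const_nhds.congr fun n => (div_self (hpos n).ne').symm
    | succ k ih =>
      have := ih.mul (h1.comp (tendsto_add_atTop_nat k))
      rw [mul_one] at this
      refine this.congr fun n => ?_
      simp only [Function.comp_apply]
      rw [div_mul_div_cancel₀ (hpos _).ne', add_assoc]
  refine (h2.comp (tendsto_sub_atTop_nat k)).congr' ?_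
  filter_upwards [eventually_ge_atTop k] with n hn
  simp only [Function.comp_apply, Nat.sub_add_cancel hn]

/-! ### The coefficients of `((1 + √(1 - w)) / 2) ^ (1/2)` -/

theorem coeff_X_mul_derivative (f : ℝ⟦X⟧) (n : ℕ) :
    PowerSeries.coeff n (PowerSeries.X * PowerSeries.derivative ℝ f) =
      n * PowerSeries.coeff n f := by
  cases n with
  | zero => simp
  | succ n =>
    rw [PowerSeries.coeff_succ_X_mul, PowerSeries.coeff_derivative]
    push_cast; ring

/-- With `θ = X d/dX` this is the hypergeometric equation `(16θ² - 8θ) G = X(16θ² - 1) G`. It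
follows by applying `θ` twice to the algebraic equation, with `v = θG` and `v' = θ²G`, and
eliminating. Its coefficients satisfy a two-term recurrence. -/
theorem differential_equation_of_sq_sub_one_sq {G : ℝ⟦X⟧}
    (hG : (2 * G ^ 2 - 1) ^ 2 = 1 - PowerSeries.X) (hG1 : PowerSeries.constantCoeff G = 1) :
    16 * (PowerSeries.X * PowerSeries.derivative ℝ
        (PowerSeries.X * PowerSeries.derivative ℝ G)) -
      8 * (PowerSeries.X * PowerSeries.derivative ℝ G) =
      PowerSeries.X * (16 * (PowerSeries.X * PowerSeries.derivative ℝ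
        (PowerSeries.X * PowerSeries.derivative ℝ G)) - G) := by
  have d2 : PowerSeries.derivative ℝ (2 : ℝ⟦X⟧) = 0 := by
    have := PowerSeries.derivative_C (R := ℝ) (r := 2); rwa [map_ofNat] at this
  have d8 : PowerSeries.derivative ℝ (8 : ℝ⟦X⟧) = 0 := by
    have := PowerSeries.derivative_C (R := ℝ) (r := 8); rwa [map_ofNat] at this
  have h1' := congrArg (fun f => PowerSeries.X * PowerSeries.derivative ℝ f) hG
  simp only [Derivation.leibniz, Derivation.leibniz_pow, map_sub, PowerSeries.derivative_X,
    smul_eq_mul, nsmul_eq_mul, PowerSeries.derivative_one, d2, Nat.cast_ofNat] at h1'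
  set v := PowerSeries.X * PowerSeries.derivative ℝ G with hv
  have h1 : 8 * ((2 * G ^ 2 - 1) * (G * v)) = -PowerSeries.X := by
    rw [hv]; linear_combination h1'
  have h2' := congrArg (fun f => PowerSeries.X * PowerSeries.derivative ℝ f) h1
  simp only [Derivation.leibniz, Derivation.leibniz_pow, map_sub, map_neg,
    PowerSeries.derivative_X, smul_eq_mul, nsmul_eq_mul, PowerSeries.derivative_one, d2, d8,
    Nat.cast_ofNat] at h2'
  set v' := PowerSeries.X * PowerSeries.derivative ℝ v with hv'
  have h2 : 8 * (4 * G ^ 2 * v ^ 2 + (2 * G ^ 2 - 1) * v ^ 2 + (2 * G ^ 2 - 1) * G * v') =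
      -PowerSeries.X := by
    rw [hv']; linear_combination h2' + 8 * (4 * G ^ 2 * v + (2 * G ^ 2 - 1) * v) * hv
  have hne : 4 * ((2 * G ^ 2 - 1) * G ^ 3) ≠ 0 := by
    intro h
    have := congrArg PowerSeries.constantCoeff h
    simp only [map_mul, map_pow, map_sub, map_one, map_ofNat, hG1, map_zero] at this
    norm_num at this
  refine mul_left_cancel₀ hne ?_
  linear_combination 8 * (1 - PowerSeries.X) * G ^ 2 * h2 +
    64 * G ^ 2 * v ^ 2 * (6 * G ^ 2 - 1) * hG -
    (6 * G ^ 2 - 1) * (8 * ((2 * G ^ 2 - 1) * (G * v)) - PowerSeries.X) * h1 -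
    4 * G ^ 2 * h1 + PowerSeries.X * (2 * G ^ 2 + 1) * hG

theorem coeff_recurrence_of_sq_sub_one_sq {G : ℝ⟦X⟧}
    (hG : (2 * G ^ 2 - 1) ^ 2 = 1 - PowerSeries.X) (hG1 : PowerSeries.constantCoeff G = 1)
    (n : ℕ) : ((n : ℝ) + 1) * (n + 1 / 2) * PowerSeries.coeff (n + 1) G =
      ((n : ℝ) ^ 2 - 1 / 16) * PowerSeries.coeff n G := by
  have h := congrArg (PowerSeries.coeff (n + 1))
    (differential_equation_of_sq_sub_one_sq hG hG1)
  rw [← map_ofNat PowerSeries.C 16, ← map_ofNat PowerSeries.C 8, map_sub,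
    PowerSeries.coeff_succ_X_mul, map_sub] at h
  simp only [PowerSeries.coeff_C_mul, coeff_X_mul_derivative] at h
  push_cast at h
  linear_combination h / 16

/-- The quantity `g n ^ 2 * n ^ 3` does not increase for `n ≥ 1`; the key inequality is `(n + 1)(n +
2) ≤ (n + 3/2)²`. -/
theorem abs_le_rpow_of_recurrence {g : ℕ → ℝ}
    (hg : ∀ n : ℕ, ((n : ℝ) + 1) * (n + 1 / 2) * g (n + 1) = ((n : ℝ) ^ 2 - 1 / 16) * g n)
    (n : ℕ) : |g (n + 1)| ≤ |g 1| * ((n : ℝ) + 1) ^ (-(3 / 2) : ℝ) := by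
  have h : g (n + 1) ^ 2 * ((n : ℝ) + 1) ^ 3 ≤ g 1 ^ 2 := by
    induction n with
    | zero => simp
    | succ n ih =>
      refine le_trans ?_ ih
      have hn : (0 : ℝ) ≤ n := n.cast_nonneg
      have e : g (n + 1 + 1) =
          (((n : ℝ) + 1) ^ 2 - 1 / 16) / ((n + 2) * (n + 3 / 2)) * g (n + 1) := by
        have := hg (n + 1)
        push_cast at this
        rw [div_mul_eq_mul_div, eq_div_iff (by positivity)]
        linear_combination this
      have hle : ((((n : ℝ) + 1) ^ 2 - 1 / 16) / ((n + 2) * (n + 3 / 2))) ^ 2 * (n + 2) ^ 3 ≤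
          (n + 1) ^ 3 := by
        rw [div_pow, div_mul_eq_mul_div, div_le_iff₀ (by positivity)]
        have h1 : (((n : ℝ) + 1) ^ 2 - 1 / 16) ^ 2 ≤ ((n + 1) ^ 2) ^ 2 :=
          pow_le_pow_left₀ (by nlinarith) (by linarith) 2
        calc (((n : ℝ) + 1) ^ 2 - 1 / 16) ^ 2 * (n + 2) ^ 3
            ≤ (((n : ℝ) + 1) ^ 2) ^ 2 * (n + 2) ^ 3 := by gcongr
          _ = ((n : ℝ) + 1) ^ 3 * (n + 2) ^ 2 * ((n + 1) * (n + 2)) := by ring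
          _ ≤ ((n : ℝ) + 1) ^ 3 * (n + 2) ^ 2 * (n + 3 / 2) ^ 2 := by
            gcongr; nlinarith
          _ = _ := by ring
      calc g (n + 1 + 1) ^ 2 * (((n + 1 : ℕ) : ℝ) + 1) ^ 3
          = g (n + 1) ^ 2 * (((((n : ℝ) + 1) ^ 2 - 1 / 16) / ((n + 2) * (n + 3 / 2))) ^ 2 *
              (n + 2) ^ 3) := by rw [e]; push_cast; ring
        _ ≤ g (n + 1) ^ 2 * (n + 1) ^ 3 := by gcongr
  have hn : (0 : ℝ) < (n : ℝ) + 1 := by positivity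
  refine (pow_le_pow_iff_left₀ (abs_nonneg _) (by positivity) two_ne_zero).1 ?_
  have hsq : (((n : ℝ) + 1) ^ (-(3 / 2) : ℝ)) ^ 2 = (((n : ℝ) + 1) ^ 3)⁻¹ := by
    rw [← Real.rpow_natCast, ← Real.rpow_mul hn.le, ← Real.rpow_natCast, ← Real.rpow_neg hn.le]
    norm_num
  rw [sq_abs, mul_pow, sq_abs, hsq, ← div_eq_mul_inv, le_div_iff₀ (by positivity)]
  exact h

theorem summable_abs_mul_rpow {g : ℕ → ℝ}
    (hg : ∀ n : ℕ, |g (n + 1)| ≤ |g 1| * ((n : ℝ) + 1) ^ (-(3 / 2) : ℝ)) :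
    Summable fun n : ℕ => |g n| * (4 / 3 * ((n : ℝ) + 1) ^ (1 / 4 : ℝ)) := by
  rw [← summable_nat_add_iff 1]
  -- The exponent is `-3/2 + 1/4 = -5/4 < -1`, and `8/3` is `4/3` times the 2 in `(n + 2)^(1/4) ≤ 2
  -- (n + 1)^(1/4)`.
  have hs : Summable fun n : ℕ => |g 1| * (8 / 3) * (((n + 1 : ℕ) : ℝ) ^ (-(5 / 4) : ℝ)) :=
    ((summable_nat_add_iff 1).2 (Real.summable_nat_rpow.2 (by norm_num))).mul_left _
  refine Summable.of_nonneg_of_le (fun n => by positivity) (fun n => ?_) hs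
  have hn : (0 : ℝ) < (n : ℝ) + 1 := by positivity
  have h1 : (((n + 1 : ℕ) : ℝ) + 1) ^ (1 / 4 : ℝ) ≤ 2 * ((n : ℝ) + 1) ^ (1 / 4 : ℝ) := by
    calc (((n + 1 : ℕ) : ℝ) + 1) ^ (1 / 4 : ℝ) ≤ (2 * ((n : ℝ) + 1)) ^ (1 / 4 : ℝ) := by
          apply Real.rpow_le_rpow (by positivity) _ (by norm_num)
          push_cast; linarith [n.cast_nonneg (α := ℝ)]
      _ = 2 ^ (1 / 4 : ℝ) * ((n : ℝ) + 1) ^ (1 / 4 : ℝ) := Real.mul_rpow (by norm_num) hn.le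
      _ ≤ 2 * ((n : ℝ) + 1) ^ (1 / 4 : ℝ) := by
          gcongr
          calc (2 : ℝ) ^ (1 / 4 : ℝ) ≤ 2 ^ (1 : ℝ) :=
                Real.rpow_le_rpow_of_exponent_le (by norm_num) (by norm_num)
            _ = 2 := Real.rpow_one 2
  calc |g (n + 1)| * (4 / 3 * (((n + 1 : ℕ) : ℝ) + 1) ^ (1 / 4 : ℝ))
      ≤ (|g 1| * ((n : ℝ) + 1) ^ (-(3 / 2) : ℝ)) * (4 / 3 * (2 * ((n : ℝ) + 1) ^ (1 / 4 : ℝ))) := by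
        gcongr
        exact hg n
    _ = |g 1| * (8 / 3) *
        (((n : ℝ) + 1) ^ (-(3 / 2) : ℝ) * ((n : ℝ) + 1) ^ (1 / 4 : ℝ)) := by ring
    _ = |g 1| * (8 / 3) * (((n + 1 : ℕ) : ℝ) ^ (-(5 / 4) : ℝ)) := by
        rw [← Real.rpow_add hn]; push_cast; norm_num

/-! ### Values at one of absolutely summable series -/

theorem PowerSeries.summable_norm_coeff_mul {f g : ℝ⟦X⟧}
    (hf : Summable fun n => ‖PowerSeries.coeff n f‖)
    (hg : Summable fun n => ‖PowerSeries.coeff n g‖) :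
    (Summable fun n => ‖PowerSeries.coeff n (f * g)‖) ∧
      ∑' n, PowerSeries.coeff n (f * g) =
        (∑' n, PowerSeries.coeff n f) * ∑' n, PowerSeries.coeff n g := by
  constructor
  · refine (summable_norm_sum_mul_antidiagonal_of_summable_norm hf hg).congr fun n => ?_
    rw [PowerSeries.coeff_mul]
  · rw [tsum_mul_tsum_eq_tsum_sum_antidiagonal_of_summable_norm hf hg]
    exact tsum_congr fun n => PowerSeries.coeff_mul _ _ _

/-- Absolute convergence makes evaluation at `X = 1` multiplicative, so `(2G(1)² - 1)² = 0`. The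
sign of `G(1)` is not decided here. -/
theorem tsum_coeff_sq_eq_half {G : ℝ⟦X⟧} (hG : (2 * G ^ 2 - 1) ^ 2 = 1 - PowerSeries.X)
    (hs : Summable fun n => ‖PowerSeries.coeff n G‖) :
    2 * (∑' n, PowerSeries.coeff n G) ^ 2 = 1 := by
  obtain ⟨h1, h2⟩ := PowerSeries.summable_norm_coeff_mul hs hs
  have hone : HasSum (fun n => PowerSeries.coeff n (1 : ℝ⟦X⟧)) 1 := by
    have h := hasSum_ite_eq (0 : ℕ) (1 : ℝ)
    refine h.congr_fun fun n => ?_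
    rw [PowerSeries.coeff_one]
  have hX : HasSum (fun n => PowerSeries.coeff n (PowerSeries.X : ℝ⟦X⟧)) 1 := by
    have h := hasSum_ite_eq (1 : ℕ) (1 : ℝ)
    refine h.congr_fun fun n => ?_
    rw [PowerSeries.coeff_X]
  have hW : HasSum (fun n => PowerSeries.coeff n (2 * G ^ 2 - 1))
      (2 * (∑' n, PowerSeries.coeff n G) ^ 2 - 1) := by
    have h := (h1.of_norm.hasSum.mul_left 2).sub hone
    rw [h2, ← pow_two (∑' n, PowerSeries.coeff n G)] at h
    refine h.congr_fun fun n => ?_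
    rw [map_sub, ← map_ofNat PowerSeries.C 2, PowerSeries.coeff_C_mul, pow_two]
  have hWn : Summable fun n => ‖PowerSeries.coeff n (2 * G ^ 2 - 1)‖ :=
    summable_norm_iff.2 hW.summable
  have h3 := (PowerSeries.summable_norm_coeff_mul hWn hWn).2
  rw [← pow_two, hG, hW.tsum_eq] at h3
  have h4 : HasSum (fun n => PowerSeries.coeff n (1 - PowerSeries.X : ℝ⟦X⟧)) (1 - 1) := by
    refine (hone.sub hX).congr_fun fun n => ?_
    rw [map_sub]
  rw [h4.tsum_eq, sub_self] at h3
  have := mul_self_eq_zero.1 h3.symm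
  linarith

/-! ### Asymptotics of the number of walks -/

/-- Tannery's theorem: each ratio `c (n - k) / c n` tends to 1 and is dominated by the weight in
`hg`. -/
theorem tendsto_coeff_mul_div {c g : ℕ → ℝ} (h0 : c 0 = 1)
    (hc : ∀ n : ℕ, ((n : ℝ) + 1) * c (n + 1) = (n + 3 / 4) * c n)
    (hg : Summable fun n : ℕ => |g n| * (4 / 3 * ((n : ℝ) + 1) ^ (1 / 4 : ℝ))) :
    Tendsto (fun n => (∑ k ∈ Finset.range (n + 1), g k * c (n - k)) / c n) atTop
      (nhds (∑' n, g n)) := by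
  have hpos := coeff_pos_of_recurrence h0 hc
  have h := tendsto_tsum_of_dominated_convergence (𝓕 := atTop)
    (f := fun n k => if k ∈ Finset.range (n + 1) then g k * (c (n - k) / c n) else 0) (g := g) hg
    (fun k => ?_) (Eventually.of_forall fun n k => ?_)
  · refine h.congr fun n => ?_
    rw [tsum_eq_sum (s := Finset.range (n + 1)) (fun k hk => if_neg hk), Finset.sum_div]
    refine Finset.sum_congr rfl fun k hk => ?_
    rw [if_pos hk, mul_div_assoc]
  · have h1 := (tendsto_coeff_sub_div h0 hc k).const_mul (g k)
    rw [mul_one] at h1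
    refine h1.congr' ?_
    filter_upwards [eventually_ge_atTop k] with n hn
    rw [if_pos (Finset.mem_range.2 (by omega))]
  · split_ifs with hk
    · rw [Real.norm_eq_abs, abs_mul, abs_of_pos (div_pos (hpos _) (hpos _))]
      gcongr
      exact coeff_sub_div_le h0 hc (Nat.lt_succ_iff.1 (Finset.mem_range.1 hk))
    · rw [norm_zero]; positivity

theorem tendsto_natCast_div_natCast_half :
    Tendsto (fun n : ℕ => (n : ℝ) / ((n / 2 : ℕ) : ℝ)) atTop (nhds 2) := by
  have h := (tendsto_nat_floor_mul_div_atTop (R := ℝ) (a := 1 / 2) (by norm_num)).comp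
    (tendsto_natCast_atTop_atTop (R := ℝ))
  have h2 := h.inv₀ (by norm_num)
  norm_num at h2
  refine h2.congr fun n => ?_
  congr 2
  rw [show (1 / 2 : ℝ) * n = (n : ℝ) / (2 : ℕ) by push_cast; ring, Nat.floor_div_eq_div]

theorem isEquivalent_numWalks :
    (fun n : ℕ => (numWalks n : ℝ)) ~[atTop]
      (fun n : ℕ =>
        1 / ((2 : ℝ) ^ (1 / 4 : ℝ) * Real.Gamma (3 / 4)) * 4 ^ n *
          (n : ℝ) ^ (-(1 / 4) : ℝ)) := by
  obtain ⟨P, G, hP, hP1, hG, hG1, hPG⟩ := exists_walkSeries_factors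
  have hΓ : 0 < Real.Gamma (3 / 4) := Real.Gamma_pos_of_pos (by norm_num)
  have h0 : PowerSeries.coeff 0 P = 1 := by
    rw [PowerSeries.coeff_zero_eq_constantCoeff_apply, hP1]
  have hc := succ_mul_coeff_of_pow_four_mul hP
  have hg := summable_abs_mul_rpow (g := fun n => PowerSeries.coeff n G)
    (abs_le_rpow_of_recurrence (g := fun n => PowerSeries.coeff n G)
      (coeff_recurrence_of_sq_sub_one_sq hG hG1))
  have hpos := coeff_pos_of_recurrence (c := fun n => PowerSeries.coeff n P) h0 hc
  have hgs : Summable fun n => ‖PowerSeries.coeff n G‖ := by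
    refine Summable.of_nonneg_of_le (fun _ => norm_nonneg _) (fun n => ?_) hg
    rw [Real.norm_eq_abs]
    refine le_mul_of_one_le_right (abs_nonneg _) ?_
    have : (1 : ℝ) ≤ ((n : ℝ) + 1) ^ (1 / 4 : ℝ) :=
      Real.one_le_rpow (by linarith [n.cast_nonneg (α := ℝ)]) (by norm_num)
    linarith
  have hlim : Tendsto (fun n => PowerSeries.coeff n (P * G) / PowerSeries.coeff n P) atTop
      (nhds (∑' n, PowerSeries.coeff n G)) := by
    refine (tendsto_coeff_mul_div (c := fun n => PowerSeries.coeff n P)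
      (g := fun n => PowerSeries.coeff n G) h0 hc hg).congr fun n => ?_
    rw [mul_comm P G, PowerSeries.coeff_mul, Finset.Nat.sum_antidiagonal_eq_sum_range_succ_mk]
  -- The coefficients of `PG` are numbers of walks up to a positive factor; this selects the
  -- positive root `G(1) = 2^(-1/2)`.
  have hnonneg : 0 ≤ ∑' n, PowerSeries.coeff n G := by
    refine ge_of_tendsto' hlim fun n => div_nonneg ?_ (hpos n).le
    have h := hPG (2 * n)
    rw [Nat.mul_div_cancel_left n two_pos] at h
    have h4 : (0 : ℝ) < 4 ^ (2 * n) := by positivity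
    have h5 : (0 : ℝ) ≤ 4 ^ (2 * n) * PowerSeries.coeff n (P * G) := h ▸ Nat.cast_nonneg _
    exact nonneg_of_mul_nonneg_right h5 h4
  have hsum : ∑' n, PowerSeries.coeff n G = (2 : ℝ) ^ (-(1 / 2) : ℝ) := by
    have h2 : ((2 : ℝ) ^ (-(1 / 2) : ℝ)) ^ 2 = 1 / 2 := by
      rw [← Real.rpow_natCast, ← Real.rpow_mul (by norm_num)]
      norm_num
    refine (pow_left_inj₀ hnonneg (by positivity) two_ne_zero).1 ?_
    rw [h2]
    linarith [tsum_coeff_sq_eq_half hG hgs]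
  rw [hsum] at hlim
  have hhalf : Tendsto (fun n : ℕ => n / 2) atTop atTop :=
    Nat.tendsto_div_const_atTop two_ne_zero
  have hpow : Tendsto (fun n : ℕ => ((n : ℝ) / ((n / 2 : ℕ) : ℝ)) ^ (1 / 4 : ℝ)) atTop
      (nhds (2 ^ (1 / 4 : ℝ))) :=
    tendsto_natCast_div_natCast_half.rpow_const (Or.inl two_ne_zero)
  have hall := (((hlim.comp hhalf).mul ((tendsto_coeff_mul_rpow (c := fun n => PowerSeries.coeff n P)
    h0 hc).comp hhalf)).mul hpow).mul
    (tendsto_const_nhds (x := (2 : ℝ) ^ (1 / 4 : ℝ) * Real.Gamma (3 / 4)))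
  -- The factor `2^(-1/2)` is `G(1)`, the first `2^(1/4)` comes from replacing `n / 2` by `n`, and
  -- the second from the claimed constant.
  have hval : (2 : ℝ) ^ (-(1 / 2) : ℝ) * (1 / Real.Gamma (3 / 4)) * 2 ^ (1 / 4 : ℝ) *
      (2 ^ (1 / 4 : ℝ) * Real.Gamma (3 / 4)) = 1 := by
    have h2 : (2 : ℝ) ^ (-(1 / 2) : ℝ) * 2 ^ (1 / 4 : ℝ) * 2 ^ (1 / 4 : ℝ) = 1 := by
      rw [← Real.rpow_add two_pos, ← Real.rpow_add two_pos]; norm_num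
    field_simp
    linear_combination h2
  rw [hval] at hall
  refine (isEquivalent_iff_tendsto_one ?_).2 (hall.congr' ?_)
  · filter_upwards [eventually_gt_atTop 0] with n hn
    have hn' : (0 : ℝ) < n := by exact_mod_cast hn
    positivity
  · filter_upwards [eventually_ge_atTop 2] with n hn
    have hn' : (0 : ℝ) < n := by exact_mod_cast (by omega : 0 < n)
    have hm : (0 : ℝ) < ((n / 2 : ℕ) : ℝ) := by exact_mod_cast (by omega : 0 < n / 2)
    simp only [Function.comp_apply, Pi.div_apply]
    rw [hPG n, Real.div_rpow hn'.le hm.le, Real.rpow_neg hn'.le]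
    have hp := (hpos (n / 2)).ne'
    have hn4 : (n : ℝ) ^ (1 / 4 : ℝ) ≠ 0 := by positivity
    have hm4 : ((n / 2 : ℕ) : ℝ) ^ (1 / 4 : ℝ) ≠ 0 := by positivity
    field_simp

theorem theorem2 :
    -- the closed form of `S(x, y; t)`, with `ρ = √(1 - 16 t²)` and
    -- `σ = (1 - 8 t² (1 + x⁻²) + ρ) ^ (1/2)`
    (∃ ρ σ : (Laurent₂ ℝ)⟦X⟧,
      IsPosRoot 2 (1 - 16 * PowerSeries.X ^ 2) ρ ∧
      IsPosRoot 2
        (1 - 8 * PowerSeries.X ^ 2 * (1 + PowerSeries.C (mon ℝ (-1) 0 ^ 2)) + ρ) σ ∧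
      slitSeries ℝ *
        (PowerSeries.C (algebraMap ℝ (Laurent₂ ℝ) (Real.sqrt 2)) *
          (1 - PowerSeries.X *
            PowerSeries.C ((mon ℝ 1 0 + mon ℝ (-1) 0) * (mon ℝ 0 1 + mon ℝ 0 (-1))))) = σ) ∧
    -- algebraicity, of degree 4, over every field of constants of characteristic zero
    (∀ (k : Type u) [Field k] [CharZero k], IsAlgebraicOfDegree k (slitSeries k) 4) ∧
    -- the specialization `x = y = 1` counts all walks by their length
    PowerSeries.map (evalOne ℝ) (slitSeries ℝ) = PowerSeries.mk (fun n => (numWalks n : ℝ)) ∧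
    -- its closed form, with `ρ = √(1 - 16 t²)`, `σ = (1 + ρ) ^ (1/2)`, `α = (1 + 4 t) ^ (1/4)` and
    -- `β = (1 - 4 t) ^ (1/4)`
    (∃ ρ σ α β : ℝ⟦X⟧,
      IsPosRoot 2 (1 - 16 * PowerSeries.X ^ 2) ρ ∧ IsPosRoot 2 (1 + ρ) σ ∧
      IsPosRoot 4 (1 + 4 * PowerSeries.X) α ∧ IsPosRoot 4 (1 - 4 * PowerSeries.X) β ∧
      PowerSeries.mk (fun n => (numWalks n : ℝ)) * (PowerSeries.C (Real.sqrt 2) * β ^ 3) =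
        α * σ) ∧
    -- the asymptotic growth
    (fun n : ℕ => (numWalks n : ℝ)) ~[atTop]
      (fun n : ℕ =>
        1 / ((2 : ℝ) ^ (1 / 4 : ℝ) * Real.Gamma (3 / 4)) * 4 ^ n * (n : ℝ) ^ (-(1 / 4) : ℝ)) := by
  exact ⟨slitSeries_real_closed_form, fun _ _ _ => isAlgebraicOfDegree_slitSeries,
    map_evalOne_slitSeries, walkSeries_closed_form, isEquivalent_numWalks⟩

end
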